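/- For a compact convex set $K\subset\mathbb{R}^2$ and $\theta\in\mathbb{R}$, let $w_K(\theta)$ be the distance between the two supporting lines of $K$ orthogonal to $(\cos\theta,\sin\theta)$. The minimal width of $K$ is $\min_\theta w_K(\theta)$. If $K$ has non-empty interior, its Cheeger constant is $$h(K)=\inf\left\{\frac{\operatorname{Per}(E)}{|E|} : E\subset K,\ E \text{ convex},\ |E|>0\right\},$$ where $|E|$ is the area of $E$ and $\operatorname{Per}(E)$ the length of its boundary. Theorem. Equilateral triangles of minimal width $1$ exist, and they maximize the Cheeger constant among convex bodies subject to the unit minimal width constraint: if $T$ is a closed equilateral triangle with $\min_\theta w_T(\theta)=1$ and $K\subset\mathbb{R}^2$ is a compact convex set with $w_K(\theta)\ge 1$ for every $\theta$, then $h(K)\le h(T)$. -/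

import Mathlib

open MeasureTheory
open scoped ENNReal

/-- The Euclidean plane. -/
abbrev Plane : Type := EuclideanSpace ℝ (Fin 2)

/-- The unit vector `(cos θ, sin θ)`. -/
noncomputable def direction (θ : ℝ) : Plane := !₂[Real.cos θ, Real.sin θ]

/-- The width `w(θ)` of a bounded set `K`: the distance between the two supporting lines of `K`
orthogonal to `(cos θ, sin θ)`, that is, the lines on which the inner product with that unit vector
takes its extreme values over `K`. -/
noncomputable def width (K : Set Plane) (θ : ℝ) : ℝ :=
  sSup ((fun x : Plane => inner ℝ (direction θ) x) '' K) -
    sInf ((fun x : Plane => inner ℝ (direction θ) x) '' K)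

/-- The width constraint: every width of `K` is at least `w`. -/
def WidthAtLeast (K : Set Plane) (w : ℝ) : Prop := ∀ θ : ℝ, w ≤ width K θ

/-- `K` has width exactly `w`: the minimum of its width function is attained and equals `w`. -/
def HasWidth (K : Set Plane) (w : ℝ) : Prop := IsLeast (Set.range (width K)) w

/-- The perimeter of a convex set with positive area: the length (one-dimensional Hausdorff
measure) of its boundary. -/
noncomputable def perimeter (E : Set Plane) : ℝ≥0∞ := μH[1] (frontier E)

/-- The Cheeger constant: the infimum of `Per(E) / |E|` over the convex subsets `E` of `K` with
positive area. -/
noncomputable def cheegerConstant (K : Set Plane) : ℝ≥0∞ :=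
  sInf {q : ℝ≥0∞ | ∃ E : Set Plane,
    E ⊆ K ∧ Convex ℝ E ∧ 0 < volume E ∧ q = perimeter E / volume E}

/-- The closed triangular region spanned by the vertices of `t`. -/
def triangleRegion (t : Affine.Triangle ℝ Plane) : Set Plane :=
  convexHull ℝ (Set.range t.points)

/-! Both Cheeger constants are compared with `1 / t`, where t = 1/(3 + √(√3 π)) solves (1 - 3t)² =
√3 π t². An equilateral triangle of width one has inradius 1/3 and area 1/√3. Its points at depth at
least t therefore form a triangle of area (1 - 3t)²/√3, and the equation says that this area is πt².

Lower bound for the triangle: every convex E inside T must satisfy |E| ≤ t Per(E). If h is the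
support function of E and g = h - t, then |E| - t Per(E) + πt² is the area functional ½∫(g² - g'²).
On an angular interval of length less than π with prescribed end values, this functional is largest
for a sinusoid. Cutting the circle at the three normals of T gives three intervals of length 2π/3,
and their maxima add up to (g₀ + g₁ + g₂)²/√3. The values of h at these normals sum to at most the
height 1; after scaling to sum 1 the bound is (1 - 3t)²/√3 = πt². The argument is run on `3 * m`
equally spaced directions, with an inscribed polygon for the perimeter and a circumscribed one for
the area (`sum_inner_le_perimeter`, `volume_le_sum_support`, `sum_support_le`), and then m tends to
infinity.

Upper bound for K: let O and r be the centre and radius of a largest inscribed disc. If r ≥ 2t, the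
disc itself is a good enough competitor. Otherwise its contact normals positively span the plane,
the width condition forces exactly three of them after a Carathéodory reduction, and it also
supplies a point of K at distance at least 1 behind each contact line. These three points span a
triangle of area A ≥ 3√3 r(1 - 2r) (`le_abs_cross_of_contact`). Shrinking it towards O by 1 - t/r
and adding a disc of radius t stays inside K. By the Steiner formulas, area minus t times perimeter
is then at least (1 - t/r)² A - πt², which is nonnegative, with r = 1/3 the critical case. -/

/-! ### Coordinates and unit directions -/

theorem inner_plane (x y : Plane) : inner ℝ x y = x 0 * y 0 + x 1 * y 1 := by
  simp [PiLp.inner_apply, Fin.sum_univ_two, mul_comm]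

theorem plane_ext {x y : Plane} (h0 : x 0 = y 0) (h1 : x 1 = y 1) : x = y := by
  ext i; fin_cases i <;> assumption

theorem norm_sq_plane (x : Plane) : ‖x‖ ^ 2 = x 0 ^ 2 + x 1 ^ 2 := by
  rw [← real_inner_self_eq_norm_sq, inner_plane]; ring

@[simp] theorem direction_zero_apply (θ : ℝ) : direction θ 0 = Real.cos θ := by
  simp [direction]

@[simp] theorem direction_one_apply (θ : ℝ) : direction θ 1 = Real.sin θ := by
  simp [direction]

theorem norm_direction (θ : ℝ) : ‖direction θ‖ = 1 := by
  have h := norm_sq_plane (direction θ)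
  simp only [direction_zero_apply, direction_one_apply, Real.cos_sq_add_sin_sq] at h
  nlinarith [norm_nonneg (direction θ)]

theorem continuous_direction : Continuous direction := by
  unfold direction
  fun_prop

theorem direction_add_two_pi (θ : ℝ) : direction (θ + 2 * Real.pi) = direction θ := by
  simp [direction]

theorem exists_direction_eq {u : Plane} (hu : ‖u‖ = 1) : ∃ θ, direction θ = u := by
  have h := norm_sq_plane u
  rw [hu] at h
  have hz : ‖(⟨u 0, u 1⟩ : ℂ)‖ = 1 := by
    rw [Complex.norm_def, Complex.normSq_mk, ← Real.sqrt_one]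
    congr 1; linarith
  have hne : (⟨u 0, u 1⟩ : ℂ) ≠ 0 := by
    intro h0; rw [h0] at hz; simp at hz
  refine ⟨Complex.arg ⟨u 0, u 1⟩, plane_ext ?_ ?_⟩
  · simp [Complex.cos_arg hne, hz]
  · simp [Complex.sin_arg, hz]

/-! ### Cross products, affine frames and triangle areas -/

/-- The cross product of two plane vectors. -/
noncomputable def cross (v w : Plane) : ℝ := v 0 * w 1 - v 1 * w 0

/-- The linear map sending the standard basis to `v`, `w`. -/
noncomputable def frameMap (v w : Plane) : Plane →ₗ[ℝ] Plane where
  toFun p := p 0 • v + p 1 • w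
  map_add' p q := by simp only [PiLp.add_apply]; module
  map_smul' c p := by simp only [PiLp.smul_apply, smul_eq_mul, RingHom.id_apply]; module

theorem frameMap_apply (v w p : Plane) : frameMap v w p = p 0 • v + p 1 • w := rfl

theorem det_frameMap (v w : Plane) : LinearMap.det (frameMap v w) = cross v w := by
  rw [← LinearMap.det_toMatrix (EuclideanSpace.basisFun (Fin 2) ℝ).toBasis, Matrix.det_fin_two]
  simp [LinearMap.toMatrix_apply, frameMap_apply, cross]
  ring

theorem volume_plane_preimage {s : Set (ℝ × ℝ)} (hs : MeasurableSet s) :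
    volume {p : Plane | (p 0, p 1) ∈ s} = volume s := by
  have h := ((volume_preserving_finTwoArrow ℝ).comp
    (EuclideanSpace.volume_preserving_symm_measurableEquiv_toLp (Fin 2))).measure_preimage
      hs.nullMeasurableSet
  rw [← h]; rfl

theorem volume_unit_square :
    volume {p : Plane | (0 < p 0 ∧ p 0 < 1) ∧ 0 < p 1 ∧ p 1 < 1} = 1 := by
  have h := volume_plane_preimage (s := Set.Ioo (0:ℝ) 1 ×ˢ Set.Ioo (0:ℝ) 1)
    (measurableSet_Ioo.prod measurableSet_Ioo)
  rw [Measure.volume_eq_prod, Measure.prod_prod] at h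
  simpa using h

theorem volume_unit_triangle :
    volume {p : Plane | 0 < p 0 ∧ 0 < p 1 ∧ p 0 + p 1 < 1} = ENNReal.ofReal (1 / 2) := by
  have hr : regionBetween (fun _ : ℝ => (0:ℝ)) (fun x => 1 - x) (Set.Ioc 0 1)
      = {p : ℝ × ℝ | 0 < p.1 ∧ 0 < p.2 ∧ p.1 + p.2 < 1} := by
    ext ⟨a, b⟩
    simp only [regionBetween, Set.mem_Ioc, Set.mem_Ioo, Set.mem_ofPred_eq]
    constructor
    · rintro ⟨⟨h1, h2⟩, h3, h4⟩; exact ⟨h1, h3, by linarith⟩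
    · rintro ⟨h1, h2, h3⟩; exact ⟨⟨h1, by linarith⟩, h2, by linarith⟩
  have hm : MeasurableSet {p : ℝ × ℝ | 0 < p.1 ∧ 0 < p.2 ∧ p.1 + p.2 < 1} := by
    rw [← hr]
    exact measurableSet_regionBetween (by fun_prop) (by fun_prop) measurableSet_Ioc
  have h := volume_plane_preimage hm
  refine h.trans ?_
  rw [← hr, Measure.volume_eq_prod, volume_regionBetween_eq_integral
    (by simp) (Continuous.integrableOn_Ioc (by fun_prop)) measurableSet_Ioc (by
      intro x hx; simpa using hx.2)]
  rw [← intervalIntegral.integral_of_le zero_le_one]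
  congr 1
  simp only [Pi.sub_apply, sub_zero]
  rw [intervalIntegral.integral_sub (by simp) (by simp)]
  simp
  norm_num

/-- The closed triangle exceeds the open one only by frontier points, and the frontier of a convex
set is null. -/
theorem volume_unit_triangle_closed_le :
    volume {p : Plane | 0 ≤ p 0 ∧ 0 ≤ p 1 ∧ p 0 + p 1 ≤ 1} ≤ ENNReal.ofReal (1 / 2) := by
  have hr : {p : Plane | 0 ≤ p 0 ∧ 0 ≤ p 1 ∧ p 0 + p 1 ≤ 1}
      ⊆ {p : Plane | 0 < p 0 ∧ 0 < p 1 ∧ p 0 + p 1 < 1} ∪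
        frontier {p : Plane | 0 ≤ p 0 ∧ 0 ≤ p 1 ∧ p 0 + p 1 ≤ 1} := by
    intro p hp
    by_cases hi : p ∈ interior {p : Plane | 0 ≤ p 0 ∧ 0 ≤ p 1 ∧ p 0 + p 1 ≤ 1}
    · left
      obtain ⟨ε, hε, hb⟩ := Metric.mem_nhds_iff.1 (mem_interior_iff_mem_nhds.1 hi)
      have key : ∀ v : Plane, ‖v‖ < ε → p + v ∈ {p : Plane | 0 ≤ p 0 ∧ 0 ≤ p 1 ∧ p 0 + p 1 ≤ 1} := by
        intro v hv; apply hb; simpa using hv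
      have n1 : ∀ θ, ‖(ε / 2) • direction θ‖ < ε := by
        intro θ; rw [norm_smul, norm_direction, Real.norm_of_nonneg (by positivity)]; linarith
      -- Each of the three moves tests one inequality: the first lowers `p 0`, the second lowers `p
      -- 1`, the third raises `p 0 + p 1`.
      have k1 := key _ (n1 Real.pi)
      have k2 := key _ (n1 (-(Real.pi / 2)))
      have k3 := key _ (n1 0)
      simp at k1 k2 k3
      exact ⟨by linarith [k1.1], by linarith [k2.2.1], by linarith [k3.2.2]⟩
    · right
      exact ⟨subset_closure hp, hi⟩
  have hc : Convex ℝ {p : Plane | 0 ≤ p 0 ∧ 0 ≤ p 1 ∧ p 0 + p 1 ≤ 1} := by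
    intro p hp q hq a b ha hb hab
    simp only [Set.mem_ofPred_eq, PiLp.add_apply, PiLp.smul_apply, smul_eq_mul] at *
    obtain ⟨h1, h2, h3⟩ := hp
    obtain ⟨h4, h5, h6⟩ := hq
    refine ⟨by positivity, by positivity, ?_⟩
    calc a * p 0 + b * q 0 + (a * p 1 + b * q 1) = a * (p 0 + p 1) + b * (q 0 + q 1) := by ring
      _ ≤ a * 1 + b * 1 := by gcongr
      _ = 1 := by linarith
  calc _ ≤ _ := measure_mono hr
    _ ≤ _ := measure_union_le _ _
    _ = _ := by rw [hc.addHaar_frontier volume, add_zero, volume_unit_triangle]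

theorem volume_frame_image (O v w : Plane) (s : Set Plane) :
    volume ((fun p : Plane => O + (p 0 • v + p 1 • w)) '' s)
      = ENNReal.ofReal |cross v w| * volume s := by
  have : (fun p : Plane => O + (p 0 • v + p 1 • w)) '' s
      = (fun x => O + x) '' (frameMap v w '' s) := by
    rw [Set.image_image]; rfl
  rw [this, ← det_frameMap, ← Measure.addHaar_image_linearMap, Set.image_add_left,
    measure_preimage_add]

/-- The filled triangle with vertices `O`, `O + v`, `O + w`. -/
def cornerTriangle (O v w : Plane) : Set Plane :=
  (fun p : Plane => O + (p 0 • v + p 1 • w)) '' {p : Plane | 0 ≤ p 0 ∧ 0 ≤ p 1 ∧ p 0 + p 1 ≤ 1}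

theorem mem_cornerTriangle {O v w x : Plane} {a b : ℝ} (ha : 0 ≤ a) (hb : 0 ≤ b) (hab : a + b ≤ 1)
    (hx : x = O + (a • v + b • w)) : x ∈ cornerTriangle O v w :=
  ⟨!₂[a, b], by simp [ha, hb, hab], by simp [hx]⟩

theorem volume_cornerTriangle_le (O v w : Plane) :
    volume (cornerTriangle O v w) ≤ ENNReal.ofReal (|cross v w| / 2) := by
  rw [cornerTriangle, volume_frame_image]
  calc _ ≤ ENNReal.ofReal |cross v w| * ENNReal.ofReal (1 / 2) := by
        gcongr; exact volume_unit_triangle_closed_le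
    _ = _ := by rw [← ENNReal.ofReal_mul (abs_nonneg _)]; congr 1; ring

/-! ### Faces and their last points -/

/-- The points of `E` at which the linear functional `direction θ` is maximal over `E`. -/
def face (E : Set Plane) (θ : ℝ) : Set Plane :=
  {x | x ∈ E ∧ ∀ z ∈ E, inner ℝ (direction θ) z ≤ inner ℝ (direction θ) x}

theorem inner_direction (θ : ℝ) (x : Plane) :
    inner ℝ (direction θ) x = Real.cos θ * x 0 + Real.sin θ * x 1 := by
  simp [inner_plane]

theorem inner_direction_add_pi_div_two (θ : ℝ) (x : Plane) :
    inner ℝ (direction (θ + Real.pi / 2)) x = -Real.sin θ * x 0 + Real.cos θ * x 1 := by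
  simp [inner_direction, Real.cos_add_pi_div_two, Real.sin_add_pi_div_two]

theorem inner_direction_add (θ α : ℝ) (x : Plane) :
    inner ℝ (direction (θ + α)) x
      = Real.cos α * inner ℝ (direction θ) x
        + Real.sin α * inner ℝ (direction (θ + Real.pi / 2)) x := by
  rw [inner_direction_add_pi_div_two, inner_direction, inner_direction, Real.cos_add, Real.sin_add]
  ring

theorem continuous_inner_direction :
    Continuous fun p : ℝ × Plane => inner ℝ (direction p.1) p.2 :=
  (continuous_direction.comp continuous_fst).inner continuous_snd

theorem face_add_two_pi (E : Set Plane) (θ : ℝ) : face E (θ + 2 * Real.pi) = face E θ := by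
  simp only [face, direction_add_two_pi]

theorem isClosed_graph_face {E : Set Plane} (hE : IsClosed E) :
    IsClosed {p : ℝ × Plane | p.2 ∈ face E p.1} := by
  have : {p : ℝ × Plane | p.2 ∈ face E p.1} = {p : ℝ × Plane | p.2 ∈ E} ∩
      ⋂ z ∈ E, {p : ℝ × Plane | inner ℝ (direction p.1) z ≤ inner ℝ (direction p.1) p.2} := by
    ext p; simp [face]
  rw [this]
  refine (hE.preimage continuous_snd).inter (isClosed_biInter fun z _ => ?_)
  exact isClosed_le ((continuous_direction.comp continuous_fst).inner continuous_const)
    continuous_inner_direction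

theorem isCompact_face {E : Set Plane} (hE : IsCompact E) (θ : ℝ) : IsCompact (face E θ) := by
  have h : IsClosed (face E θ) :=
    (isClosed_graph_face hE.isClosed).preimage (f := fun x : Plane => (θ, x)) (by fun_prop)
  exact hE.of_isClosed_subset h fun x hx => hx.1

theorem convex_face {E : Set Plane} (hE : Convex ℝ E) (θ : ℝ) : Convex ℝ (face E θ) := by
  intro x hx y hy a b ha hb hab
  refine ⟨hE hx.1 hy.1 ha hb hab, fun z hz => ?_⟩
  rw [inner_add_right, inner_smul_right, inner_smul_right]
  calc inner ℝ (direction θ) z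
      = a * inner ℝ (direction θ) z + b * inner ℝ (direction θ) z := by rw [← add_mul, hab, one_mul]
    _ ≤ _ := by gcongr <;> [exact hx.2 z hz; exact hy.2 z hz]

theorem face_nonempty {E : Set Plane} (hE : IsCompact E) (hne : E.Nonempty) (θ : ℝ) :
    (face E θ).Nonempty := by
  obtain ⟨x, hx, hmax⟩ := hE.exists_isMaxOn hne
    (f := fun x => inner ℝ (direction θ) x) (by fun_prop)
  exact ⟨x, hx, fun z hz => hmax hz⟩

theorem face_subset_frontier {E : Set Plane} (θ : ℝ) : face E θ ⊆ frontier E := by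
  intro x hx
  refine ⟨subset_closure hx.1, fun hi => ?_⟩
  obtain ⟨ε, hε, hb⟩ := Metric.mem_nhds_iff.1 (mem_interior_iff_mem_nhds.1 hi)
  have hz : x + (ε / 2) • direction θ ∈ E := by
    apply hb
    simp [norm_smul, norm_direction, abs_of_pos hε, hε]
  have h := hx.2 _ hz
  rw [inner_add_right, inner_smul_right, real_inner_self_eq_norm_sq, norm_direction] at h
  linarith

/-- For angles less than π apart, an intermediate direction is a nonnegative combination of the two
outer ones, so a common maximiser of the outer functionals also maximises it. -/
theorem mem_face_of_between {E : Set Plane} {θ φ θ' : ℝ} (h1 : θ ≤ φ) (h2 : φ ≤ θ')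
    (h3 : θ' - θ < Real.pi) {x : Plane} (hx : x ∈ face E θ) (hx' : x ∈ face E θ') :
    x ∈ face E φ := by
  rcases h1.eq_or_lt with rfl | h1'
  · exact hx
  refine ⟨hx.1, fun z hz => ?_⟩
  have key : ∀ y : Plane, Real.sin (θ' - θ) * inner ℝ (direction φ) y
      = Real.sin (θ' - φ) * inner ℝ (direction θ) y
        + Real.sin (φ - θ) * inner ℝ (direction θ') y := by
    intro y
    simp only [inner_direction, Real.sin_sub]
    ring
  have hs : 0 < Real.sin (θ' - θ) := Real.sin_pos_of_pos_of_lt_pi (by linarith) h3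
  have hs1 : 0 ≤ Real.sin (θ' - φ) := Real.sin_nonneg_of_nonneg_of_le_pi (by linarith) (by linarith)
  have hs2 : 0 ≤ Real.sin (φ - θ) := Real.sin_nonneg_of_nonneg_of_le_pi (by linarith) (by linarith)
  have h : Real.sin (θ' - θ) * inner ℝ (direction φ) z
      ≤ Real.sin (θ' - θ) * inner ℝ (direction φ) x := by
    rw [key, key]
    gcongr
    · exact hx.2 z hz
    · exact hx'.2 z hz
  exact le_of_mul_le_mul_left h hs

/-- A point in two opposite faces would make the functional constant on `E`, putting interior points
on the frontier. -/
theorem not_mem_face_opposite {E : Set Plane} (hE : (interior E).Nonempty) {θ : ℝ} {x : Plane}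
    (hx : x ∈ face E θ) : x ∉ face E (θ + Real.pi) := by
  intro hx'
  obtain ⟨y, hy⟩ := hE
  have hyE := interior_subset hy
  have h1 := hx.2 y hyE
  have h2 := hx'.2 y hyE
  simp only [inner_direction_add θ Real.pi, Real.cos_pi, Real.sin_pi] at h2
  have hy' : y ∈ face E θ := ⟨hyE, fun z hz => by linarith [hx.2 z hz]⟩
  exact (face_subset_frontier θ hy').2 hy

/-- `x` is the last point, in counterclockwise order, of the face of `E` in direction `θ`. -/
def IsLastPoint (E : Set Plane) (θ : ℝ) (x : Plane) : Prop :=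
  x ∈ face E θ ∧ ∀ z ∈ face E θ,
    inner ℝ (direction (θ + Real.pi / 2)) z ≤ inner ℝ (direction (θ + Real.pi / 2)) x

theorem exists_isLastPoint {E : Set Plane} (hE : IsCompact E) (hne : E.Nonempty) (θ : ℝ) :
    ∃ x, IsLastPoint E θ x := by
  obtain ⟨x, hx, hmax⟩ := (isCompact_face hE θ).exists_isMaxOn (face_nonempty hE hne θ)
    (f := fun x => inner ℝ (direction (θ + Real.pi / 2)) x) (by fun_prop)
  exact ⟨x, hx, fun z hz => hmax hz⟩

theorem IsLastPoint.unique {E : Set Plane} {θ : ℝ} {x y : Plane} (hx : IsLastPoint E θ x)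
    (hy : IsLastPoint E θ y) : x = y := by
  have h1 := le_antisymm (hx.1.2 y hy.1.1) (hy.1.2 x hx.1.1)
  have h2 := le_antisymm (hx.2 y hy.1) (hy.2 x hx.1)
  rw [inner_direction_add_pi_div_two, inner_direction_add_pi_div_two] at h2
  rw [inner_direction, inner_direction] at h1
  have h := Real.cos_sq_add_sin_sq θ
  apply plane_ext
  · linear_combination (-x 0 + y 0) * h - Real.cos θ * h1 + Real.sin θ * h2
  · linear_combination (-x 1 + y 1) * h - Real.sin θ * h1 - Real.cos θ * h2

/-- On the face at `φ` the functional at `θ` differs from the tangential coordinate only by a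
positive factor and a constant, so maximising it forces the last position. -/
theorem isLastPoint_of_mem_face {E : Set Plane} {φ θ : ℝ} (h1 : φ < θ) (h2 : θ < φ + Real.pi)
    {x : Plane} (hx : x ∈ face E φ) (hx' : x ∈ face E θ) : IsLastPoint E φ x := by
  refine ⟨hx, fun z hz => ?_⟩
  have e : inner ℝ (direction φ) z = inner ℝ (direction φ) x :=
    le_antisymm (hx.2 z hz.1) (hz.2 x hx.1)
  have h := hx'.2 z hz.1
  obtain ⟨α, rfl⟩ : ∃ α, θ = φ + α := ⟨θ - φ, by ring⟩
  rw [inner_direction_add, inner_direction_add φ α x, e] at h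
  have hs : 0 < Real.sin α := Real.sin_pos_of_pos_of_lt_pi (by linarith) (by linarith)
  exact le_of_mul_le_mul_left (by linarith) hs

/-- A choice of the last point of the face of `E` in direction `θ`. -/
noncomputable def lastPoint (E : Set Plane) (θ : ℝ) : Plane :=
  Classical.epsilon (IsLastPoint E θ)

theorem isLastPoint_lastPoint {E : Set Plane} (hE : IsCompact E) (hne : E.Nonempty) (θ : ℝ) :
    IsLastPoint E θ (lastPoint E θ) :=
  Classical.epsilon_spec (exists_isLastPoint hE hne θ)

theorem lastPoint_add_two_pi (E : Set Plane) (θ : ℝ) :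
    lastPoint E (θ + 2 * Real.pi) = lastPoint E θ := by
  have : θ + 2 * Real.pi + Real.pi / 2 = θ + Real.pi / 2 + 2 * Real.pi := by ring
  have h : IsLastPoint E (θ + 2 * Real.pi) = IsLastPoint E θ := by
    funext x
    simp only [IsLastPoint, face_add_two_pi, this, direction_add_two_pi]
  rw [lastPoint, h, lastPoint]

/-! ### Boundary arcs and the perimeter from below -/

/-- The part of the boundary of `E` with a normal angle in `[α, β]`, without the face in
direction `α`. -/
def boundaryArc (E : Set Plane) (α β : ℝ) : Set Plane :=
  (Prod.snd '' ({p : ℝ × Plane | p.2 ∈ face E p.1} ∩ Set.Icc α β ×ˢ E)) \ face E α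

theorem mem_boundaryArc {E : Set Plane} {α β : ℝ} {x : Plane} :
    x ∈ boundaryArc E α β ↔ (∃ θ ∈ Set.Icc α β, x ∈ face E θ) ∧ x ∉ face E α := by
  constructor
  · rintro ⟨⟨⟨θ, y⟩, ⟨h1, h2, -⟩, rfl⟩, h3⟩
    exact ⟨⟨θ, h2, h1⟩, h3⟩
  · rintro ⟨⟨θ, h1, h2⟩, h3⟩
    exact ⟨⟨(θ, x), ⟨h2, h1, h2.1⟩, rfl⟩, h3⟩

theorem measurableSet_boundaryArc {E : Set Plane} (hE : IsCompact E) (α β : ℝ) :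
    MeasurableSet (boundaryArc E α β) := by
  refine MeasurableSet.diff ?_ (isCompact_face hE α).isClosed.measurableSet
  refine IsClosed.measurableSet (IsCompact.isClosed ?_)
  exact ((isCompact_Icc.prod hE).inter_left (isClosed_graph_face hE.isClosed)).image continuous_snd

theorem boundaryArc_subset_frontier (E : Set Plane) (α β : ℝ) :
    boundaryArc E α β ⊆ frontier E := by
  intro x hx
  obtain ⟨⟨θ, -, h⟩, -⟩ := mem_boundaryArc.1 hx
  exact face_subset_frontier θ h

/-- The map from angles to faces has closed graph and nonempty convex values, so by connectedness
the tangential coordinate cannot skip a value on the way from one last point to the next. -/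
theorem Ioo_subset_image_boundaryArc {E : Set Plane} (hE : IsCompact E) (hc : Convex ℝ E)
    (hne : E.Nonempty) {α δ : ℝ} (hδ : 0 < δ) (hδ' : δ < Real.pi) :
    Set.Ioo (inner ℝ (direction (α + δ / 2 + Real.pi / 2)) (lastPoint E α))
        (inner ℝ (direction (α + δ / 2 + Real.pi / 2)) (lastPoint E (α + δ)))
      ⊆ (fun x => inner ℝ (direction (α + δ / 2 + Real.pi / 2)) x) '' boundaryArc E α (α + δ) := by
  rintro s ⟨hs1, hs2⟩
  set τ := direction (α + δ / 2 + Real.pi / 2) with hτ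
  set G := {p : ℝ × Plane | p.2 ∈ face E p.1} ∩ Set.Icc α (α + δ) ×ˢ E with hG
  have hGc : IsCompact G :=
    (isCompact_Icc.prod hE).inter_left (isClosed_graph_face hE.isClosed)
  have hcont : Continuous fun p : ℝ × Plane => inner ℝ τ p.2 := by fun_prop
  have hC1 : IsClosed (Prod.fst '' (G ∩ {p | inner ℝ τ p.2 ≤ s})) :=
    ((hGc.inter_right (isClosed_le hcont continuous_const)).image continuous_fst).isClosed
  have hC2 : IsClosed (Prod.fst '' (G ∩ {p | s ≤ inner ℝ τ p.2})) :=
    ((hGc.inter_right (isClosed_le continuous_const hcont)).image continuous_fst).isClosed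
  have hα : α ∈ Set.Icc α (α + δ) := ⟨le_rfl, by linarith⟩
  have hβ : α + δ ∈ Set.Icc α (α + δ) := ⟨by linarith, le_rfl⟩
  have hL := isLastPoint_lastPoint hE hne
  -- The angles whose face meets `{≤ s}` and those whose face meets `{≥ s}` are two closed nonempty
  -- sets covering the interval, so some angle lies in both.
  obtain ⟨θ, hθ, ⟨⟨_, x⟩, ⟨⟨hx, -⟩, hxs⟩, rfl⟩, ⟨⟨_, y⟩, ⟨⟨hy, -⟩, hys⟩, he⟩⟩ :=
    isPreconnected_closed_iff.1 (isPreconnected_Icc (a := α) (b := α + δ)) _ _ hC1 hC2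
      (by
        intro θ hθ
        obtain ⟨x, hx⟩ := face_nonempty hE hne θ
        rcases le_total (inner ℝ τ x) s with h | h
        · exact Or.inl ⟨(θ, x), ⟨⟨hx, hθ, hx.1⟩, h⟩, rfl⟩
        · exact Or.inr ⟨(θ, x), ⟨⟨hx, hθ, hx.1⟩, h⟩, rfl⟩)
      ⟨α, hα, (α, lastPoint E α), ⟨⟨(hL α).1, hα, (hL α).1.1⟩, hs1.le⟩, rfl⟩
      ⟨α + δ, hβ, (α + δ, lastPoint E (α + δ)),
        ⟨⟨(hL (α + δ)).1, hβ, (hL (α + δ)).1.1⟩, hs2.le⟩, rfl⟩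
  simp only at he hx hy hxs hys hθ
  subst he
  rename_i θ
  obtain ⟨z, hz, hzs⟩ : ∃ z ∈ face E θ, inner ℝ τ z = s := by
    have := (convex_face hc θ).isPreconnected.intermediate_value hx hy
      (f := fun z => inner ℝ τ z) (by fun_prop) ⟨hxs, hys⟩
    exact this
  refine ⟨z, mem_boundaryArc.2 ⟨⟨θ, hθ, hz⟩, fun hzα => ?_⟩, hzs⟩
  have e1 := (hL α).2 z hzα
  have e2 := le_antisymm ((hL α).1.2 z hzα.1) (hzα.2 _ (hL α).1.1)
  -- On the face at `α` the `τ`-coordinate is largest at the last point, where it is already below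
  -- `s`; hence `z` is not on that face.
  have key : ∀ w, inner ℝ τ w = Real.cos (δ / 2) * inner ℝ (direction (α + Real.pi / 2)) w
      - Real.sin (δ / 2) * inner ℝ (direction α) w := by
    intro w
    rw [hτ, inner_direction_add_pi_div_two, inner_direction_add_pi_div_two, inner_direction,
      Real.sin_add, Real.cos_add]
    ring
  have hcos : 0 < Real.cos (δ / 2) :=
    Real.cos_pos_of_mem_Ioo ⟨by linarith, by linarith⟩
  rw [← hzs, key, key, e2] at hs1
  nlinarith

/-- Projection to a unit direction is 1-Lipschitz and so does not increase length. Deleting a finite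
set costs nothing, which later allows the arcs to be made disjoint. -/
theorem ofReal_le_hausdorffMeasure_boundaryArc {E : Set Plane} (hE : IsCompact E)
    (hc : Convex ℝ E) (hne : E.Nonempty) {α δ : ℝ} (hδ : 0 < δ) (hδ' : δ < Real.pi)
    {S : Set Plane} (hS : S.Finite) :
    ENNReal.ofReal (inner ℝ (direction (α + δ / 2 + Real.pi / 2))
        (lastPoint E (α + δ) - lastPoint E α))
      ≤ μH[1] (boundaryArc E α (α + δ) \ S) := by
  set τ := direction (α + δ / 2 + Real.pi / 2) with hτ
  have hlip : LipschitzWith 1 (fun x : Plane => inner ℝ τ x) := by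
    refine LipschitzWith.of_dist_le_mul fun x y => ?_
    rw [Real.dist_eq, ← inner_sub_right, dist_eq_norm]
    calc _ ≤ ‖τ‖ * ‖x - y‖ := abs_real_inner_le_norm _ _
      _ = _ := by rw [hτ, norm_direction]; simp
  have h1 := hlip.hausdorffMeasure_image_le zero_le_one (boundaryArc E α (α + δ) \ S)
  simp only [ENNReal.coe_one, ENNReal.one_rpow, one_mul] at h1
  refine le_trans ?_ h1
  rw [hausdorffMeasure_real, inner_sub_right, ← Real.volume_Ioo]
  rw [← measure_sdiff_null (s := Set.Ioo _ _) ((hS.image fun x => inner ℝ τ x).measure_zero volume)]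
  refine measure_mono ?_
  rintro s ⟨hs, hs'⟩
  obtain ⟨x, hx, rfl⟩ := Ioo_subset_image_boundaryArc hE hc hne hδ hδ' hs
  exact ⟨x, ⟨hx, fun h => hs' ⟨x, h, rfl⟩⟩, rfl⟩

/-- A point with normals in two separate angular ranges has all the normals between them on the
shorter way round, so it is the corner ending one of the ranges. Normals exactly π apart are
impossible for a body with interior. -/
theorem mem_lastPoints_of_mem_boundaryArc {E : Set Plane} (hE : IsCompact E)
    (hi : (interior E).Nonempty) {α β α' β' : ℝ} (h2 : β ≤ α') (h4 : β' ≤ α + 2 * Real.pi) {x : Plane} (hx : x ∈ boundaryArc E α β)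
    (hx' : x ∈ boundaryArc E α' β') : x = lastPoint E β ∨ x = lastPoint E β' := by
  have hL := isLastPoint_lastPoint hE (hi.mono interior_subset)
  obtain ⟨⟨θ, hθ, hxθ⟩, hxα⟩ := mem_boundaryArc.1 hx
  obtain ⟨⟨θ', hθ', hxθ'⟩, hxα'⟩ := mem_boundaryArc.1 hx'
  have n1 : α < θ := lt_of_le_of_ne hθ.1 fun h => hxα (h ▸ hxθ)
  have n2 : α' < θ' := lt_of_le_of_ne hθ'.1 fun h => hxα' (h ▸ hxθ')
  rcases lt_trichotomy (θ' - θ) Real.pi with h | h | h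
  · left
    have hm := mem_face_of_between hθ.2 (by linarith : β ≤ θ') h hxθ hxθ'
    exact (isLastPoint_of_mem_face (by linarith) (by linarith [hθ.2]) hm hxθ').unique (hL β)
  · exact absurd hxθ' (by
      have : θ' = θ + Real.pi := by linarith
      rw [this]
      exact not_mem_face_opposite hi hxθ)
  · right
    have hx2 : x ∈ face E (θ + 2 * Real.pi) := by rwa [face_add_two_pi]
    have hm := mem_face_of_between hθ'.2 (by linarith : β' ≤ θ + 2 * Real.pi) (by linarith) hxθ' hx2
    exact (isLastPoint_of_mem_face (by linarith) (by linarith [hθ'.2]) hm hx2).unique (hL β')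

/-- The length of the boundary of a convex body dominates the length of the polygon inscribed at
the contact points of equally spaced supporting lines. -/
theorem sum_inner_le_perimeter {E : Set Plane} (hE : IsCompact E) (hc : Convex ℝ E)
    (hi : (interior E).Nonempty) (θ₀ : ℝ) {N : ℕ} {δ : ℝ} (hN : N * δ = 2 * Real.pi) (hδ : 0 < δ)
    (hδ' : δ < Real.pi) :
    ENNReal.ofReal (∑ k ∈ Finset.range N, inner ℝ (direction (θ₀ + k * δ + δ / 2 + Real.pi / 2))
      (lastPoint E (θ₀ + k * δ + δ) - lastPoint E (θ₀ + k * δ))) ≤ perimeter E := by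
  have hne := hi.mono interior_subset
  -- Distinct arcs can meet only at these junction points, which are removed to gain disjointness.
  set S : Set Plane := (fun k : ℕ => lastPoint E (θ₀ + k * δ + δ)) '' (Finset.range N) with hS
  have hSf : S.Finite := (Finset.finite_toSet _).image _
  have hd : Set.PairwiseDisjoint (Finset.range N : Set ℕ)
      fun k => boundaryArc E (θ₀ + k * δ) (θ₀ + k * δ + δ) \ S := by
    have main : ∀ j k : ℕ, j < k → k < N → ∀ x,
        x ∈ boundaryArc E (θ₀ + j * δ) (θ₀ + j * δ + δ) →
        x ∈ boundaryArc E (θ₀ + k * δ) (θ₀ + k * δ + δ) → x ∈ S := by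
      intro j k hjk hk x hx hx'
      have c1 : (j : ℝ) + 1 ≤ k := by exact_mod_cast hjk
      have c2 : (k : ℝ) + 1 ≤ N := by exact_mod_cast hk
      have c3 : (0 : ℝ) ≤ j := by positivity
      rcases mem_lastPoints_of_mem_boundaryArc hE hi (by nlinarith)
        (by nlinarith) hx hx' with h | h
      · exact ⟨j, by simpa using hjk.trans hk, h.symm⟩
      · exact ⟨k, by simpa using hk, h.symm⟩
    intro j hj k hk hjk
    simp only [Finset.coe_range, Set.mem_Iio] at hj hk
    refine Set.disjoint_left.2 fun x hx hx' => ?_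
    rcases lt_or_gt_of_ne hjk with h | h
    · exact hx.2 (main j k h hk x hx.1 hx'.1)
    · exact hx.2 (main k j h hj x hx'.1 hx.1)
  calc _ ≤ ∑ k ∈ Finset.range N, ENNReal.ofReal
        (inner ℝ (direction (θ₀ + k * δ + δ / 2 + Real.pi / 2))
          (lastPoint E (θ₀ + k * δ + δ) - lastPoint E (θ₀ + k * δ))) := by
        refine Finset.le_sum_of_subadditive ENNReal.ofReal (by simp)
          (fun a b => ENNReal.ofReal_add_le) _ _
    _ ≤ ∑ k ∈ Finset.range N, μH[1] (boundaryArc E (θ₀ + k * δ) (θ₀ + k * δ + δ) \ S) :=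
        Finset.sum_le_sum fun k _ =>
          ofReal_le_hausdorffMeasure_boundaryArc hE hc hne hδ hδ' hSf
    _ = μH[1] (⋃ k ∈ Finset.range N, boundaryArc E (θ₀ + k * δ) (θ₀ + k * δ + δ) \ S) :=
        (measure_biUnion_finset hd fun k _ =>
          (measurableSet_boundaryArc hE _ _).diff hSf.measurableSet).symm
    _ ≤ _ := by
        refine measure_mono (Set.iUnion₂_subset fun k _ => ?_)
        exact Set.sdiff_subset.trans (boundaryArc_subset_frontier E _ _)

/-! ### Area of a circumscribed equiangular polygon -/

theorem sum_range_shift {M : Type*} [AddCommGroup M] (f : ℕ → M) {N : ℕ} (h : f N = f 0) :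
    ∑ k ∈ Finset.range N, f (k + 1) = ∑ k ∈ Finset.range N, f k := by
  have h1 := Finset.sum_range_succ f N
  have h2 := Finset.sum_range_succ' f N
  rw [h1, h] at h2
  exact (add_right_cancel h2).symm

/-- A unit vector as a difference of neighbouring tangents. This makes sums over equally spaced
normals telescope and drives the summation by parts that turns edge lengths into support numbers. -/
theorem two_sin_mul_inner_direction (φ δ : ℝ) (y : Plane) :
    2 * Real.sin (δ / 2) * inner ℝ (direction φ) y
      = inner ℝ (direction (φ - δ / 2 + Real.pi / 2)) y
        - inner ℝ (direction (φ + δ / 2 + Real.pi / 2)) y := by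
  rw [inner_direction_add_pi_div_two, inner_direction_add_pi_div_two, inner_direction,
    Real.sin_sub, Real.cos_sub, Real.sin_add, Real.cos_add]
  ring

theorem sum_inner_direction_eq_zero (θ₀ : ℝ) {N : ℕ} {δ : ℝ} (hN : N * δ = 2 * Real.pi)
    (hδ : 0 < δ) (hδ' : δ < Real.pi) (y : Plane) :
    ∑ k ∈ Finset.range N, inner ℝ (direction (θ₀ + k * δ)) y = 0 := by
  have hs : 0 < Real.sin (δ / 2) := Real.sin_pos_of_pos_of_lt_pi (by linarith) (by linarith)
  have h : 2 * Real.sin (δ / 2) * ∑ k ∈ Finset.range N, inner ℝ (direction (θ₀ + k * δ)) y = 0 := by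
    rw [Finset.mul_sum]
    have e : ∀ k ∈ Finset.range N, 2 * Real.sin (δ / 2) * inner ℝ (direction (θ₀ + k * δ)) y
        = (fun k : ℕ => inner ℝ (direction (θ₀ + k * δ - δ / 2 + Real.pi / 2)) y) k
          - (fun k : ℕ => inner ℝ (direction (θ₀ + k * δ - δ / 2 + Real.pi / 2)) y) (k + 1) := by
      intro k _
      rw [two_sin_mul_inner_direction]
      congr 4
      push_cast; ring
    rw [Finset.sum_congr rfl e, Finset.sum_range_sub', sub_eq_zero, hN]
    have : θ₀ + 2 * Real.pi - δ / 2 + Real.pi / 2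
        = θ₀ - δ / 2 + Real.pi / 2 + 2 * Real.pi := by ring
    simp [this, direction_add_two_pi]
  rcases mul_eq_zero.1 h with h | h
  · linarith
  · exact h

/-- The triangle cut out of a circumscribed equiangular polygon by the centre `O` and the side with
normal angle `φ`, when the support numbers of this side and its neighbours are `h`, `h₁`, `h₂`. -/
theorem mem_sector_triangle {O x : Plane} {φ δ h h₁ h₂ s : ℝ} (hδ : 0 < Real.sin δ)
    (hl : 2 * Real.cos δ * h ≤ h₁ + h₂) (hs : 0 ≤ s) (hs1 : s ≤ 1)
    (e : inner ℝ (direction φ) (x - O) = s * h)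
    (e₁ : inner ℝ (direction (φ - δ)) (x - O) ≤ s * h₁)
    (e₂ : inner ℝ (direction (φ + δ)) (x - O) ≤ s * h₂) :
    x ∈ cornerTriangle O (h • direction φ
        - ((h₁ - h * Real.cos δ) / Real.sin δ) • direction (φ + Real.pi / 2))
      (h • direction φ + ((h₂ - h * Real.cos δ) / Real.sin δ) • direction (φ + Real.pi / 2)) := by
  set y := x - O with hy
  set b := inner ℝ (direction (φ + Real.pi / 2)) y with hb
  set d := (h₁ - h * Real.cos δ) / Real.sin δ with hd
  set c := (h₂ - h * Real.cos δ) / Real.sin δ with hc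
  have hyb : y = (s * h) • direction φ + b • direction (φ + Real.pi / 2) := by
    have hp := Real.cos_sq_add_sin_sq φ
    rw [← e, hb, inner_direction_add_pi_div_two, inner_direction]
    apply plane_ext <;>
    simp [Real.cos_add_pi_div_two, Real.sin_add_pi_div_two]
    · linear_combination (-y 0) * hp
    · linear_combination (-y 1) * hp
  -- The two neighbouring constraints confine the tangential coordinate `b` to `[-s d, s c]`, the
  -- slice of the sector at height `s * h`.
  have f1 : -(s * d) ≤ b := by
    rw [sub_eq_add_neg, inner_direction_add, e, Real.cos_neg, Real.sin_neg, ← hb] at e₁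
    rw [hd, neg_le, ← mul_div_assoc, le_div_iff₀ hδ]
    linarith
  have f2 : b ≤ s * c := by
    rw [inner_direction_add, e, ← hb] at e₂
    rw [hc, ← mul_div_assoc, le_div_iff₀ hδ]
    linarith
  have hl' : 0 ≤ c + d := by
    rw [hc, hd, ← add_div]
    apply div_nonneg _ hδ.le
    linarith
  have hx : x = O + y := by rw [hy]; abel
  rcases hl'.eq_or_lt with h0 | hpos
  -- A side of length zero: the triangle degenerates to a segment, and `x` lies on it.
  · refine mem_cornerTriangle (a := s) (b := 0) hs le_rfl (by linarith) ?_
    have : b = -(s * d) := by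
      have : c = -d := by linarith
      rw [this] at f2
      linarith
    rw [hx, hyb, this]
    module
  · refine mem_cornerTriangle (a := (s * c - b) / (c + d)) (b := (b + s * d) / (c + d))
      (div_nonneg (by linarith) hl') (div_nonneg (by linarith) hl') ?_ ?_
    · rw [← add_div, div_le_one hpos]
      nlinarith
    · rw [hx, hyb]
      congr 1
      have k1 : (s * c - b) / (c + d) + (b + s * d) / (c + d) = s := by field_simp; ring
      have k2 : (b + s * d) / (c + d) * c - (s * c - b) / (c + d) * d = b := by field_simp; ring
      generalize (s * c - b) / (c + d) = p at *
      generalize (b + s * d) / (c + d) = q at *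
      rw [← k1, ← k2]
      module

theorem cross_sector_triangle (φ h c d : ℝ) :
    cross (h • direction φ - d • direction (φ + Real.pi / 2))
      (h • direction φ + c • direction (φ + Real.pi / 2)) = h * (c + d) := by
  simp only [cross, PiLp.sub_apply, PiLp.add_apply, PiLp.smul_apply, smul_eq_mul,
    direction_zero_apply, direction_one_apply, Real.cos_add_pi_div_two, Real.sin_add_pi_div_two]
  linear_combination (h * (c + d)) * Real.cos_sq_add_sin_sq φ

/-- The area of a set is at most that of a circumscribed equiangular polygon. -/
theorem volume_le_sum_support {E : Set Plane} (O : Plane) (θ₀ : ℝ) {N : ℕ} {δ : ℝ}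
    (hN : N * δ = 2 * Real.pi) (hδ : 0 < δ) (hδ' : δ < Real.pi) {h : ℕ → ℝ}
    (hper : ∀ k, h (k + N) = h k) (hpos : ∀ k, 0 < h k)
    (hE : ∀ x ∈ E, ∀ k : ℕ, inner ℝ (direction (θ₀ + k * δ)) (x - O) ≤ h k)
    (hl : ∀ k, 2 * Real.cos δ * h (k + 1) ≤ h k + h (k + 2)) :
    volume E ≤ ENNReal.ofReal
      ((∑ k ∈ Finset.range N, (h k * h (k + 1) - Real.cos δ * h k ^ 2)) / Real.sin δ) := by
  have hsin : 0 < Real.sin δ := Real.sin_pos_of_pos_of_lt_pi hδ hδ'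
  have hN0 : 0 < N := by
    rcases Nat.eq_zero_or_pos N with rfl | h0
    · simp at hN
    · exact h0
  set T : ℕ → Set Plane := fun k => cornerTriangle O (h (k + 1) • direction (θ₀ + (k + 1 : ℕ) * δ)
        - ((h k - h (k + 1) * Real.cos δ) / Real.sin δ)
          • direction (θ₀ + (k + 1 : ℕ) * δ + Real.pi / 2))
      (h (k + 1) • direction (θ₀ + (k + 1 : ℕ) * δ)
        + ((h (k + 2) - h (k + 1) * Real.cos δ) / Real.sin δ)
          • direction (θ₀ + (k + 1 : ℕ) * δ + Real.pi / 2)) with hT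
  have hcover : E ⊆ ⋃ k ∈ Finset.range N, T k := by
    intro x hx
    -- The maximum of these ratios is the gauge of the polygon at `x`; an index attaining it names a
    -- sector containing `x`.
    set g : ℕ → ℝ := fun k => inner ℝ (direction (θ₀ + k * δ)) (x - O) / h k with hg
    have hgper : ∀ k, g (k + N) = g k := by
      intro k
      simp only [hg, hper]
      have : θ₀ + ((k + N : ℕ) : ℝ) * δ = θ₀ + k * δ + 2 * Real.pi := by
        push_cast; linear_combination hN
      rw [this, direction_add_two_pi]
    obtain ⟨K, hK, hmax⟩ := Finset.exists_max_image (Finset.range N) (fun k => g (k + 1))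
      ⟨0, by simpa using hN0⟩
    have hmax' : ∀ j, g j ≤ g (K + 1) := by
      intro j
      have hp : Function.Periodic (fun k => g (k + 1)) N := fun k => by
        have := hgper (k + 1)
        simpa only [add_right_comm] using this
      -- Adding `N` before subtracting 1 keeps the natural subtraction exact when `j = 0`.
      have h1 := hp.map_mod_nat (j + N - 1)
      have h2 := hmax ((j + N - 1) % N) (by simpa using Nat.mod_lt _ hN0)
      rw [h1, show j + N - 1 + 1 = j + N by omega, hgper] at h2
      exact h2
    have hle : ∀ j : ℕ, inner ℝ (direction (θ₀ + j * δ)) (x - O) ≤ g (K + 1) * h j := by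
      intro j
      exact (div_le_iff₀ (hpos j)).1 (hmax' j)
    -- The normals sum to zero, so the functionals cannot all be negative at `x - O`.
    have hs : 0 ≤ g (K + 1) := by
      by_contra hneg
      push Not at hneg
      have hsum := sum_inner_direction_eq_zero θ₀ hN hδ hδ' (x - O)
      have : ∑ k ∈ Finset.range N, inner ℝ (direction (θ₀ + k * δ)) (x - O) < 0 :=
        Finset.sum_neg (fun j _ => (hle j).trans_lt (mul_neg_of_neg_of_pos hneg (hpos j)))
          ⟨0, by simpa using hN0⟩
      linarith
    refine Set.mem_iUnion₂.2 ⟨K, hK, mem_sector_triangle hsin (hl K) hs ?_ ?_ ?_ ?_⟩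
    · exact (div_le_one (hpos _)).2 (hE x hx _)
    · rw [hg]; field_simp [(hpos (K + 1)).ne']
    · have := hle K
      rwa [show θ₀ + ((K + 1 : ℕ) : ℝ) * δ - δ = θ₀ + K * δ by push_cast; ring]
    · have := hle (K + 2)
      rwa [show θ₀ + ((K + 1 : ℕ) : ℝ) * δ + δ = θ₀ + (K + 2 : ℕ) * δ by push_cast; ring]
  have harea : ∀ k, volume (T k) ≤ ENNReal.ofReal
      (h (k + 1) * ((h k + h (k + 2) - 2 * Real.cos δ * h (k + 1)) / Real.sin δ) / 2) := by
    intro k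
    refine (volume_cornerTriangle_le _ _ _).trans_eq ?_
    rw [cross_sector_triangle, ← add_div]
    rw [abs_of_nonneg (mul_nonneg (hpos _).le (div_nonneg (by linarith [hl k]) hsin.le))]
    congr 4; ring
  calc volume E ≤ ∑ k ∈ Finset.range N, volume (T k) :=
        (measure_mono hcover).trans (measure_biUnion_finset_le _ _)
    _ ≤ ∑ k ∈ Finset.range N, ENNReal.ofReal
      (h (k + 1) * ((h k + h (k + 2) - 2 * Real.cos δ * h (k + 1)) / Real.sin δ) / 2) :=
        Finset.sum_le_sum fun k _ => harea k
    _ = ENNReal.ofReal (∑ k ∈ Finset.range N,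
      (h (k + 1) * ((h k + h (k + 2) - 2 * Real.cos δ * h (k + 1)) / Real.sin δ) / 2)) := by
        rw [ENNReal.ofReal_sum_of_nonneg]
        intro k _
        exact div_nonneg (mul_nonneg (hpos _).le (div_nonneg (by linarith [hl k]) hsin.le)) zero_le_two
    _ = _ := by
        congr 1
        have s1 := sum_range_shift (fun k => h k * h (k + 1)) (N := N) (by
          have h0 := hper 0; have h1 := hper 1
          rw [zero_add] at h0; rw [add_comm] at h1
          simp only [h0, h1, zero_add])
        have s2 := sum_range_shift (fun k => h k ^ 2) (N := N) (by
          have h0 := hper 0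
          rw [zero_add] at h0
          simp only [h0])
        rw [Finset.sum_sub_distrib, ← Finset.mul_sum, ← s2, Finset.mul_sum, eq_div_iff hsin.ne',
          Finset.sum_mul]
        have s3 : ∑ k ∈ Finset.range N, h k * h (k + 1)
            = ∑ k ∈ Finset.range N, (h k * h (k + 1) + h (k + 1) * h (k + 1 + 1)) / 2 := by
          rw [← Finset.sum_div, Finset.sum_add_distrib, s1]; ring
        rw [s3, ← Finset.sum_sub_distrib]
        refine Finset.sum_congr rfl fun k _ => ?_
        field_simp

/-! ### The quadratic form on support numbers -/

/-- The extremal value of the quadratic form `∑ (aₖ aₖ₊₁ - cos δ (aₖ² + aₖ₊₁²) / 2) / (sin δ / 2)`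
over sequences spanning the angle `L` with end values `a`, `b`. -/
noncomputable def arcForm (L a b : ℝ) : ℝ := (2 * a * b - (a ^ 2 + b ^ 2) * Real.cos L) / Real.sin L

/-- The defect is a perfect square in `b` over a positive product of sines. It vanishes exactly when
`b` lies on the sinusoid interpolating `a` and `c`. -/
theorem arcForm_add_le {L M : ℝ} (hL : 0 < L) (hM : 0 < M) (hLM : L + M < Real.pi) (a b c : ℝ) :
    arcForm L a b + arcForm M b c ≤ arcForm (L + M) a c := by
  have h1 : 0 < Real.sin L := Real.sin_pos_of_pos_of_lt_pi hL (by linarith)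
  have h2 : 0 < Real.sin M := Real.sin_pos_of_pos_of_lt_pi hM (by linarith)
  have h3 : 0 < Real.sin (L + M) := Real.sin_pos_of_pos_of_lt_pi (by linarith) hLM
  have key : arcForm (L + M) a c - (arcForm L a b + arcForm M b c)
      = (b * Real.sin (L + M) - a * Real.sin M - c * Real.sin L) ^ 2
        / (Real.sin L * Real.sin M * Real.sin (L + M)) := by
    unfold arcForm
    field_simp
    have c1 := Real.sin_sq L
    have c2 := Real.sin_sq M
    rw [Real.cos_add, Real.sin_add]
    have e1 := Real.sin_sq_add_cos_sq L
    have e2 := Real.sin_sq_add_cos_sq M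
    generalize Real.sin L = sL at *
    generalize Real.sin M = sM at *
    generalize Real.cos L = cL at *
    generalize Real.cos M = cM at *
    have d1 : cL ^ 2 = 1 - sL ^ 2 := by linarith
    have d2 : cM ^ 2 = 1 - sM ^ 2 := by linarith
    grind
  have : 0 ≤ arcForm (L + M) a c - (arcForm L a b + arcForm M b c) := by
    rw [key]; positivity
  linarith

theorem sum_le_arcForm {δ : ℝ} (hδ : 0 < δ) (g : ℕ → ℝ) (a : ℕ) {j : ℕ} (hj : 0 < j)
    (hjδ : j * δ < Real.pi) :
    ∑ k ∈ Finset.range j, (g (a + k) * g (a + k + 1)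
        - Real.cos δ / 2 * (g (a + k) ^ 2 + g (a + k + 1) ^ 2))
      ≤ Real.sin δ / 2 * arcForm (j * δ) (g a) (g (a + j)) := by
  have hstep : ∀ x y : ℝ, 0 < Real.sin δ → x * y - Real.cos δ / 2 * (x ^ 2 + y ^ 2)
      = Real.sin δ / 2 * arcForm δ x y := by
    intro x y hs
    unfold arcForm
    field_simp
  induction j, hj using Nat.le_induction with
  | base =>
    simp only [Nat.cast_one, one_mul] at *
    rw [← hstep _ _ (Real.sin_pos_of_pos_of_lt_pi hδ hjδ)]
    simp
  | succ j hj ih =>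
    have hj' : (1 : ℝ) ≤ j := by exact_mod_cast hj
    push_cast at hjδ ⊢
    have hs := Real.sin_pos_of_pos_of_lt_pi hδ (by nlinarith)
    have ih := ih (by linarith)
    rw [Finset.sum_range_succ, hstep _ _ hs]
    have h := arcForm_add_le (L := j * δ) (M := δ) (by positivity) hδ (by linarith)
      (g a) (g (a + j)) (g (a + j + 1))
    calc _ ≤ Real.sin δ / 2 * (arcForm (j * δ) (g a) (g (a + j))
          + arcForm δ (g (a + j)) (g (a + j + 1))) := by rw [mul_add]; gcongr
      _ ≤ Real.sin δ / 2 * arcForm (j * δ + δ) (g a) (g (a + j + 1)) := by gcongr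
      _ = _ := by rw [add_mul, one_mul, add_assoc a j 1]

/-- At angle 2π/3 the cosine is -1/2, exactly the value that completes the three cross terms to a
square. -/
theorem arcForm_two_pi_div_three_sum (a b c : ℝ) :
    arcForm (2 * Real.pi / 3) a b + arcForm (2 * Real.pi / 3) b c + arcForm (2 * Real.pi / 3) c a
      = 2 / Real.sqrt 3 * (a + b + c) ^ 2 := by
  have e : 2 * Real.pi / 3 = Real.pi - Real.pi / 3 := by ring
  unfold arcForm
  rw [e, Real.cos_pi_sub, Real.sin_pi_sub, Real.cos_pi_div_three, Real.sin_pi_div_three]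
  field_simp
  ring

/-- This is `x ≤ tan x` at `x = δ / 2`. Geometrically, a disc has no more area than its
circumscribed regular polygon. -/
theorem mul_sin_le_two_mul_one_sub_cos {δ : ℝ} (hδ : 0 < δ) (hδ' : δ < Real.pi) :
    δ * Real.sin δ ≤ 2 * (1 - Real.cos δ) := by
  obtain ⟨x, rfl⟩ : ∃ x, δ = 2 * x := ⟨δ / 2, by ring⟩
  have hx : 0 < x := by linarith
  have hc : 0 < Real.cos x := Real.cos_pos_of_mem_Ioo ⟨by linarith, by linarith⟩
  have hs : 0 < Real.sin x := Real.sin_pos_of_pos_of_lt_pi hx (by linarith)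
  have h := Real.lt_tan hx (by linarith)
  rw [Real.tan_eq_sin_div_cos, lt_div_iff₀ hc] at h
  rw [Real.sin_two_mul, Real.cos_two_mul, Real.cos_sq']
  nlinarith

/-- Discrete form of |E| ≤ t Per(E). Substituting `h = g + t` leaves the quadratic form in `g`,
bounded on three blocks of angle 2π/3 by `arcForm`. The choice of `t` makes the resulting bound `sin
δ * (π t²)`, which the constant term of the substitution absorbs. -/
theorem sum_support_le_of_sum_eq_one {m : ℕ} {δ t : ℝ} (hm : 0 < m)
    (hδ : m * δ = 2 * Real.pi / 3) (ht : (1 - 3 * t) ^ 2 = Real.sqrt 3 * Real.pi * t ^ 2)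
    {h : ℕ → ℝ} (hper : ∀ k, h (k + 3 * m) = h k) (hH : h 0 + h m + h (2 * m) = 1) :
    ∑ k ∈ Finset.range (3 * m), (h k * h (k + 1) - Real.cos δ * h k ^ 2)
      ≤ 2 * t * (1 - Real.cos δ) * ∑ k ∈ Finset.range (3 * m), h k := by
  have hm' : (1 : ℝ) ≤ m := by exact_mod_cast hm
  have hδ0 : 0 < δ := by
    by_contra hn
    push Not at hn
    nlinarith [Real.pi_pos]
  have hδπ : δ < Real.pi := by nlinarith [Real.pi_pos]
  have hs := Real.sin_pos_of_pos_of_lt_pi hδ0 hδπ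
  set g : ℕ → ℝ := fun k => h k - t with hg
  set F : ℕ → ℝ := fun k => g k * g (k + 1) - Real.cos δ / 2 * (g k ^ 2 + g (k + 1) ^ 2) with hF
  have hblock : ∀ a, ∑ k ∈ Finset.range m, F (a + k)
      ≤ Real.sin δ / 2 * arcForm (2 * Real.pi / 3) (g a) (g (a + m)) := by
    intro a
    have := sum_le_arcForm hδ0 g a hm (by rw [hδ]; linarith [Real.pi_pos])
    rwa [hδ] at this
  have hsplit : ∑ k ∈ Finset.range (3 * m), F k = ∑ k ∈ Finset.range m, F (0 + k)
      + ∑ k ∈ Finset.range m, F (m + k) + ∑ k ∈ Finset.range m, F (2 * m + k) := by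
    rw [show 3 * m = m + m + m by ring, Finset.sum_range_add, Finset.sum_range_add]
    simp only [zero_add, two_mul]
  have hg3 : g (2 * m + m) = g 0 := by
    have := hper 0
    simp only [hg]
    rw [show 2 * m + m = 0 + 3 * m by ring, this]
  have hsum : ∑ k ∈ Finset.range (3 * m), F k ≤ Real.sin δ * (Real.pi * t ^ 2) := by
    have hb0 := hblock 0
    have hb1 := hblock m
    have hb2 := hblock (2 * m)
    rw [zero_add] at hb0
    rw [← two_mul] at hb1
    rw [hg3] at hb2
    have h3 := arcForm_two_pi_div_three_sum (g 0) (g m) (g (2 * m))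
    have h4 : (g 0 + g m + g (2 * m)) ^ 2 = Real.sqrt 3 * Real.pi * t ^ 2 := by
      rw [← ht]; simp only [hg]; congr 1; linarith
    have h5 : 2 / Real.sqrt 3 * (Real.sqrt 3 * Real.pi * t ^ 2) = 2 * (Real.pi * t ^ 2) := by
      field_simp
    rw [h4, h5] at h3
    calc _ ≤ Real.sin δ / 2 * (arcForm (2 * Real.pi / 3) (g 0) (g m)
          + arcForm (2 * Real.pi / 3) (g m) (g (2 * m))
          + arcForm (2 * Real.pi / 3) (g (2 * m)) (g 0)) := by rw [hsplit]; linarith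
      _ = _ := by rw [h3]; ring
  have p0 : h (3 * m) = h 0 := by simpa using hper 0
  have s1 := sum_range_shift h p0
  have s2 := sum_range_shift (fun k => h k ^ 2) (N := 3 * m) (by simp only [p0])
  -- The symmetrised form `F` is used because it splits into blocks; the correction `h (k + 1) ^ 2 -
  -- h k ^ 2` telescopes over the cycle.
  have hterm : ∀ k, h k * h (k + 1) - Real.cos δ * h k ^ 2
      = F k + t * (1 - Real.cos δ) * (h k + h (k + 1)) - t ^ 2 * (1 - Real.cos δ)
        + Real.cos δ / 2 * (h (k + 1) ^ 2 - h k ^ 2) := by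
    intro k; simp only [hF, hg]; ring
  simp only [hterm, Finset.sum_add_distrib, Finset.sum_sub_distrib, ← Finset.mul_sum, s1, s2,
    Finset.sum_const, Finset.card_range, nsmul_eq_mul]
  have hc := mul_sin_le_two_mul_one_sub_cos hδ0 hδπ
  -- The disc of radius `t` has at most the area of the regular `3 * m`-gon circumscribed about it.
  have h6 : Real.sin δ * (Real.pi * t ^ 2) ≤ ((3 * m : ℕ) : ℝ) * (t ^ 2 * (1 - Real.cos δ)) := by
    have : Real.pi = 3 / 2 * (m * δ) := by rw [hδ]; ring
    rw [this]; push_cast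
    nlinarith [mul_le_mul_of_nonneg_left hc (by positivity : 0 ≤ (m : ℝ) * t ^ 2)]
  linarith

/-- By homogeneity: the left side is quadratic and the right side linear and nonnegative, so a sum
below 1 only helps. -/
theorem sum_support_le {m : ℕ} {δ t : ℝ} (hm : 0 < m) (hδ : m * δ = 2 * Real.pi / 3) (ht0 : 0 ≤ t)
    (ht : (1 - 3 * t) ^ 2 = Real.sqrt 3 * Real.pi * t ^ 2)
    {h : ℕ → ℝ} (hper : ∀ k, h (k + 3 * m) = h k) (hpos : ∀ k, 0 < h k)
    (hH : h 0 + h m + h (2 * m) ≤ 1) :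
    ∑ k ∈ Finset.range (3 * m), (h k * h (k + 1) - Real.cos δ * h k ^ 2)
      ≤ 2 * t * (1 - Real.cos δ) * ∑ k ∈ Finset.range (3 * m), h k := by
  set H := h 0 + h m + h (2 * m) with hHdef
  have hH0 : 0 < H := by have := hpos 0; have := hpos m; have := hpos (2 * m); positivity
  have key := sum_support_le_of_sum_eq_one (h := fun k => h k / H) hm hδ ht
    (fun k => by simp only [hper]) (by rw [← add_div, ← add_div]; exact div_self hH0.ne')
  have e1 : ∑ k ∈ Finset.range (3 * m), (h k / H * (h (k + 1) / H) - Real.cos δ * (h k / H) ^ 2)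
      = (∑ k ∈ Finset.range (3 * m), (h k * h (k + 1) - Real.cos δ * h k ^ 2)) / H ^ 2 := by
    rw [Finset.sum_div]
    refine Finset.sum_congr rfl fun k _ => ?_
    field_simp
  rw [e1, ← Finset.sum_div, ← mul_div_assoc, div_le_div_iff₀ (by positivity) hH0] at key
  have hR : 0 ≤ 2 * t * (1 - Real.cos δ) * ∑ k ∈ Finset.range (3 * m), h k := by
    have : 0 ≤ 1 - Real.cos δ := by linarith [Real.cos_le_one δ]
    have : 0 ≤ ∑ k ∈ Finset.range (3 * m), h k := Finset.sum_nonneg fun k _ => (hpos k).le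
    positivity
  have k2 : ∑ k ∈ Finset.range (3 * m), (h k * h (k + 1) - Real.cos δ * h k ^ 2)
      ≤ 2 * t * (1 - Real.cos δ) * (∑ k ∈ Finset.range (3 * m), h k) * H := by
    refine le_of_mul_le_mul_right ?_ hH0
    linarith
  exact k2.trans (mul_le_of_le_one_right hR hH)

/-! ### The isoperimetric bound and the Cheeger constant from below -/

theorem inner_lt_of_mem_interior {E : Set Plane} {O x : Plane} {θ : ℝ} (hO : O ∈ interior E)
    (hx : x ∈ face E θ) : inner ℝ (direction θ) O < inner ℝ (direction θ) x := by
  refine lt_of_le_of_ne (hx.2 O (interior_subset hO)) fun h => ?_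
  have hf : O ∈ face E θ := ⟨interior_subset hO, fun z hz => (hx.2 z hz).trans_eq h.symm⟩
  exact (face_subset_frontier θ hf).2 hO

/-- The factor `cos (π / (3 m))`, the cosine of half the angular step, is the loss from using
projected edge lengths for the perimeter but a circumscribed polygon for the area. -/
theorem ofReal_mul_volume_le_perimeter_of_grid {E : Set Plane} (hE : IsCompact E)
    (hc : Convex ℝ E) (hi : (interior E).Nonempty) {t : ℝ} (ht0 : 0 < t)
    (ht : (1 - 3 * t) ^ 2 = Real.sqrt 3 * Real.pi * t ^ 2) (θ₀ : ℝ)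
    (hT : ∀ x ∈ E, ∀ y ∈ E, ∀ z ∈ E, inner ℝ (direction θ₀) x
      + inner ℝ (direction (θ₀ + 2 * Real.pi / 3)) y
      + inner ℝ (direction (θ₀ + 2 * (2 * Real.pi / 3))) z ≤ 1) {m : ℕ} (hm : 0 < m) :
    ENNReal.ofReal (Real.cos (Real.pi / (3 * m)) / t) * volume E ≤ perimeter E := by
  obtain ⟨O, hO⟩ := id hi
  have hne := hi.mono interior_subset
  have hm' : (1 : ℝ) ≤ m := by exact_mod_cast hm
  set δ : ℝ := 2 * Real.pi / (3 * m) with hδdef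
  have hδ : 0 < δ := by positivity
  have hmδ : m * δ = 2 * Real.pi / 3 := by rw [hδdef]; field_simp
  have hδ' : δ < Real.pi := by nlinarith [Real.pi_pos]
  have hN : ((3 * m : ℕ) : ℝ) * δ = 2 * Real.pi := by push_cast; linarith
  have hs := Real.sin_pos_of_pos_of_lt_pi hδ hδ'
  have hs2 : 0 < Real.sin (δ / 2) := Real.sin_pos_of_pos_of_lt_pi (by linarith) (by linarith)
  have hc2 : 0 < Real.cos (δ / 2) := Real.cos_pos_of_mem_Ioo ⟨by linarith, by linarith⟩
  set X : ℕ → Plane := fun k => lastPoint E (θ₀ + k * δ) with hX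
  have hXf : ∀ k : ℕ, X k ∈ face E (θ₀ + k * δ) := fun k => (isLastPoint_lastPoint hE hne _).1
  have hang : ∀ k : ℕ, θ₀ + ((k + 3 * m : ℕ) : ℝ) * δ = θ₀ + k * δ + 2 * Real.pi := by
    intro k; rw [← hN]; push_cast; ring
  have hXper : ∀ k, X (k + 3 * m) = X k := by
    intro k; simp only [hX, hang, lastPoint_add_two_pi]
  set h : ℕ → ℝ := fun k => inner ℝ (direction (θ₀ + k * δ)) (X k - O) with hh
  have hpos : ∀ k, 0 < h k := by
    intro k
    have := inner_lt_of_mem_interior hO (hXf k)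
    simp only [hh, inner_sub_right]; linarith
  have hper : ∀ k, h (k + 3 * m) = h k := by
    intro k; simp only [hh, hXper, hang, direction_add_two_pi]
  have hle : ∀ x ∈ E, ∀ k : ℕ, inner ℝ (direction (θ₀ + k * δ)) (x - O) ≤ h k := by
    intro x hx k
    have := (hXf k).2 x hx
    simp only [hh, inner_sub_right]; linarith
  -- The contact point `X (k + 1)` obeys both neighbouring constraints; adding them cancels its
  -- tangential coordinate.
  have hl : ∀ k, 2 * Real.cos δ * h (k + 1) ≤ h k + h (k + 2) := by
    intro k
    have h1 := hle _ (hXf (k + 1)).1 k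
    have h2 := hle _ (hXf (k + 1)).1 (k + 2)
    rw [show θ₀ + (k : ℝ) * δ = θ₀ + (k + 1 : ℕ) * δ + -δ by push_cast; ring,
      inner_direction_add] at h1
    rw [show θ₀ + ((k + 2 : ℕ) : ℝ) * δ = θ₀ + (k + 1 : ℕ) * δ + δ by push_cast; ring,
      inner_direction_add] at h2
    rw [Real.cos_neg, Real.sin_neg] at h1
    have e : h (k + 1) = inner ℝ (direction (θ₀ + (k + 1 : ℕ) * δ)) (X (k + 1) - O) := rfl
    rw [← e] at h1 h2
    linarith
  -- Measuring from `O` does not change the sum, because the three directions add up to zero.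
  have hH : h 0 + h m + h (2 * m) ≤ 1 := by
    have h3 := hT _ (hXf 0).1 _ (hXf m).1 _ (hXf (2 * m)).1
    have h0 := sum_inner_direction_eq_zero θ₀ (N := 3) (δ := 2 * Real.pi / 3)
      (by push_cast; ring) (by positivity) (by linarith [Real.pi_pos]) O
    simp only [Finset.sum_range_succ, Finset.sum_range_zero, Nat.cast_zero, Nat.cast_one,
      zero_mul, add_zero, zero_add, one_mul, Nat.cast_ofNat] at h0
    simp only [hh, inner_sub_right]
    rw [show ((2 * m : ℕ) : ℝ) * δ = 2 * (2 * Real.pi / 3) by push_cast; linarith, hmδ,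
      Nat.cast_zero, zero_mul, add_zero]
    linarith
  have hmain := sum_support_le hm hmδ ht0.le ht hper hpos hH
  have hvol := volume_le_sum_support O θ₀ hN hδ hδ' hper hpos hle hl
  have hP := sum_inner_le_perimeter hE hc hi θ₀ hN hδ hδ'
  -- Summation by parts around the cycle: the edge projections regroup by vertex, each giving `2 sin
  -- (δ / 2)` times its support number.
  have hPs : ∑ k ∈ Finset.range (3 * m), inner ℝ
      (direction (θ₀ + k * δ + δ / 2 + Real.pi / 2))
      (lastPoint E (θ₀ + k * δ + δ) - lastPoint E (θ₀ + k * δ))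
      = 2 * Real.sin (δ / 2) * ∑ k ∈ Finset.range (3 * m), h k := by
    have sh := sum_range_shift (fun k : ℕ => inner ℝ
      (direction (θ₀ + k * δ - δ / 2 + Real.pi / 2)) (X k - O)) (N := 3 * m) (by
        have e := hXper 0
        have e' := hang 0
        rw [zero_add] at e e'
        simp only [e, e']
        rw [show θ₀ + ((0 : ℕ) : ℝ) * δ + 2 * Real.pi - δ / 2 + Real.pi / 2
          = θ₀ + ((0 : ℕ) : ℝ) * δ - δ / 2 + Real.pi / 2 + 2 * Real.pi by ring,
          direction_add_two_pi])
    rw [Finset.mul_sum]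
    simp only [hh, two_sin_mul_inner_direction]
    rw [Finset.sum_sub_distrib, ← sh, ← Finset.sum_sub_distrib]
    refine Finset.sum_congr rfl fun k _ => ?_
    have e1 : θ₀ + ((k + 1 : ℕ) : ℝ) * δ - δ / 2 + Real.pi / 2
        = θ₀ + k * δ + δ / 2 + Real.pi / 2 := by push_cast; ring
    have e2 : θ₀ + ((k + 1 : ℕ) : ℝ) * δ = θ₀ + k * δ + δ := by push_cast; ring
    rw [e1, ← inner_sub_right]
    simp only [hX, e2]
    congr 1; abel
  rw [hPs] at hP
  have hcδ : Real.pi / (3 * m) = δ / 2 := by rw [hδdef]; ring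
  rw [hcδ]
  set S := ∑ k ∈ Finset.range (3 * m), h k with hS
  set Q := ∑ k ∈ Finset.range (3 * m), (h k * h (k + 1) - Real.cos δ * h k ^ 2) with hQ
  calc _ ≤ ENNReal.ofReal (Real.cos (δ / 2) / t) * ENNReal.ofReal (Q / Real.sin δ) := by gcongr
    _ = ENNReal.ofReal (Real.cos (δ / 2) / t * (Q / Real.sin δ)) :=
        (ENNReal.ofReal_mul (by positivity)).symm
    _ ≤ ENNReal.ofReal (2 * Real.sin (δ / 2) * S) := by
        apply ENNReal.ofReal_le_ofReal
        rw [div_mul_div_comm, div_le_iff₀ (by positivity)]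
        have e3 : Real.sin δ = 2 * Real.sin (δ / 2) * Real.cos (δ / 2) := by
          rw [← Real.sin_two_mul]; congr 1; ring
        have e4 : 1 - Real.cos δ = 2 * Real.sin (δ / 2) ^ 2 := by
          have : Real.cos δ = Real.cos (2 * (δ / 2)) := by congr 1; ring
          rw [this, Real.cos_two_mul, Real.cos_sq']; ring
        rw [e4] at hmain
        rw [e3]
        calc Real.cos (δ / 2) * Q
            ≤ Real.cos (δ / 2) * (2 * t * (2 * Real.sin (δ / 2) ^ 2) * S) := by gcongr
          _ = _ := by ring
    _ ≤ _ := hP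

theorem ofReal_mul_volume_le_perimeter {E : Set Plane} (hE : IsCompact E)
    (hc : Convex ℝ E) (hi : (interior E).Nonempty) {t : ℝ} (ht0 : 0 < t)
    (ht : (1 - 3 * t) ^ 2 = Real.sqrt 3 * Real.pi * t ^ 2) (θ₀ : ℝ)
    (hT : ∀ x ∈ E, ∀ y ∈ E, ∀ z ∈ E, inner ℝ (direction θ₀) x
      + inner ℝ (direction (θ₀ + 2 * Real.pi / 3)) y
      + inner ℝ (direction (θ₀ + 2 * (2 * Real.pi / 3))) z ≤ 1) :
    ENNReal.ofReal (1 / t) * volume E ≤ perimeter E := by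
  have hV : volume E ≠ ∞ := hE.measure_lt_top.ne
  have hlim : Filter.Tendsto (fun m : ℕ => Real.cos (Real.pi / (3 * m)) / t) Filter.atTop
      (nhds (1 / t)) := by
    refine Filter.Tendsto.div_const ?_ t
    rw [← Real.cos_zero]
    refine (Real.continuous_cos.tendsto 0).comp ?_
    refine Filter.Tendsto.div_atTop tendsto_const_nhds ?_
    exact Filter.Tendsto.const_mul_atTop (by norm_num) tendsto_natCast_atTop_atTop
  have hlim' := ENNReal.Tendsto.mul_const (ENNReal.tendsto_ofReal hlim) (b := volume E) (Or.inr hV)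
  refine le_of_tendsto hlim' ?_
  filter_upwards [Filter.eventually_gt_atTop 0] with m hm
  exact ofReal_mul_volume_le_perimeter_of_grid hE hc hi ht0 ht θ₀ hT hm

/-- A competitor need not be closed. Its closure stays in `K`, has no smaller area and no larger
frontier, and has interior points since convex frontiers are null. -/
theorem ofReal_le_cheegerConstant {K : Set Plane} (hK : IsCompact K) {t : ℝ} (ht0 : 0 < t)
    (ht : (1 - 3 * t) ^ 2 = Real.sqrt 3 * Real.pi * t ^ 2) (θ₀ : ℝ)
    (hT : ∀ x ∈ K, ∀ y ∈ K, ∀ z ∈ K, inner ℝ (direction θ₀) x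
      + inner ℝ (direction (θ₀ + 2 * Real.pi / 3)) y
      + inner ℝ (direction (θ₀ + 2 * (2 * Real.pi / 3))) z ≤ 1) :
    ENNReal.ofReal (1 / t) ≤ cheegerConstant K := by
  refine le_sInf ?_
  rintro q ⟨E, hEK, hEc, hEv, rfl⟩
  have hcl : closure E ⊆ K := closure_minimal hEK hK.isClosed
  have hcc : IsCompact (closure E) := hK.of_isClosed_subset isClosed_closure hcl
  have hfin : volume E ≠ ∞ := (hcc.measure_lt_top.trans_le' (measure_mono subset_closure)).ne
  rw [ENNReal.le_div_iff_mul_le (Or.inl hEv.ne') (Or.inl hfin)]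
  have hi : (interior (closure E)).Nonempty := by
    by_contra hn
    rw [Set.not_nonempty_iff_eq_empty] at hn
    have h1 : closure E ⊆ frontier (closure E) := by
      intro x hx
      exact ⟨subset_closure hx, by simp [hn]⟩
    have h2 : volume E ≤ 0 := by
      rw [← hEc.closure.addHaar_frontier volume]
      exact measure_mono (subset_closure.trans h1)
    exact absurd h2 (not_le.2 hEv)
  calc _ ≤ ENNReal.ofReal (1 / t) * volume (closure E) := by gcongr; exact subset_closure
    _ ≤ perimeter (closure E) := ofReal_mul_volume_le_perimeter hcc hEc.closure hi ht0 ht θ₀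
        fun x hx y hy z hz => hT x (hcl hx) y (hcl hy) z (hcl hz)
    _ ≤ _ := measure_mono frontier_closure_subset

/-! ### Widths and equilateral triangles -/

theorem isCompact_image_inner_direction {K : Set Plane} (hK : IsCompact K) (θ : ℝ) :
    IsCompact ((fun x : Plane => inner ℝ (direction θ) x) '' K) :=
  hK.image (by fun_prop)

theorem inner_sub_le_width {K : Set Plane} (hK : IsCompact K) {θ : ℝ} {x y : Plane} (hx : x ∈ K)
    (hy : y ∈ K) : inner ℝ (direction θ) (x - y) ≤ width K θ := by
  have h := isCompact_image_inner_direction hK θ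
  rw [inner_sub_right]
  exact sub_le_sub (le_csSup h.bddAbove ⟨x, hx, rfl⟩) (csInf_le h.bddBelow ⟨y, hy, rfl⟩)

theorem width_le {K : Set Plane} (hK : K.Nonempty) {θ m M : ℝ}
    (h : ∀ x ∈ K, m ≤ inner ℝ (direction θ) x ∧ inner ℝ (direction θ) x ≤ M) :
    width K θ ≤ M - m := by
  refine sub_le_sub (csSup_le (hK.image _) ?_) (le_csInf (hK.image _) ?_)
  · rintro _ ⟨x, hx, rfl⟩; exact (h x hx).2
  · rintro _ ⟨x, hx, rfl⟩; exact (h x hx).1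

theorem exists_inner_sub_ge_width {K : Set Plane} (hK : IsCompact K) (hne : K.Nonempty) (θ : ℝ) :
    ∃ x ∈ K, ∃ y ∈ K, width K θ = inner ℝ (direction θ) (x - y) := by
  have h := isCompact_image_inner_direction hK θ
  obtain ⟨x, hx, ex⟩ := h.sSup_mem (hne.image _)
  obtain ⟨y, hy, ey⟩ := h.sInf_mem (hne.image _)
  exact ⟨x, hx, y, hy, by
    rw [inner_sub_right]; exact (congrArg₂ (· - ·) ex ey).symm⟩

/-- The closed equilateral triangle with vertex `a`, side `s` and the two sides at `a` pointing in
the directions `φ`, `φ + π / 3`. -/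
def equilateralRegion (a : Plane) (s φ : ℝ) : Set Plane :=
  convexHull ℝ {a, a + s • direction φ, a + s • direction (φ + Real.pi / 3)}

theorem isCompact_equilateralRegion (a : Plane) (s φ : ℝ) :
    IsCompact (equilateralRegion a s φ) :=
  Set.Finite.isCompact_convexHull ℝ (by simp)

theorem inner_direction_direction (θ φ : ℝ) :
    inner ℝ (direction θ) (direction φ) = Real.cos (θ - φ) := by
  rw [inner_direction, Real.cos_sub]; simp

theorem inner_le_of_mem_convexHull {S : Set Plane} {v : Plane} {c : ℝ}
    (h : ∀ x ∈ S, inner ℝ v x ≤ c) {x : Plane} (hx : x ∈ convexHull ℝ S) : inner ℝ v x ≤ c :=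
  convexHull_min h (convex_halfSpace_le (innerₛₗ ℝ v).isLinear c) hx

theorem le_inner_of_mem_convexHull {S : Set Plane} {v : Plane} {c : ℝ}
    (h : ∀ x ∈ S, c ≤ inner ℝ v x) {x : Plane} (hx : x ∈ convexHull ℝ S) : c ≤ inner ℝ v x :=
  convexHull_min h (convex_halfSpace_ge (innerₛₗ ℝ v).isLinear c) hx

/-- The side projections `x`, `z`, `x + z` have squares summing to 3s²/2, and one of them is in
absolute value the sum of the other two. Its square is thus at least 3s²/4. -/
theorem le_width_equilateralRegion (a : Plane) (s φ θ : ℝ) :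
    Real.sqrt 3 / 2 * s ≤ width (equilateralRegion a s φ) θ := by
  set W := width (equilateralRegion a s φ) θ with hW
  have hK := isCompact_equilateralRegion a s φ
  have ha : a ∈ equilateralRegion a s φ := subset_convexHull ℝ _ (by simp)
  have hb : a + s • direction φ ∈ equilateralRegion a s φ := subset_convexHull ℝ _ (by simp)
  have hc : a + s • direction (φ + Real.pi / 3) ∈ equilateralRegion a s φ :=
    subset_convexHull ℝ _ (by simp)
  have h1 := inner_sub_le_width hK (θ := θ) hb ha
  have h2 := inner_sub_le_width hK (θ := θ) ha hb
  have h3 := inner_sub_le_width hK (θ := θ) hc ha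
  have h4 := inner_sub_le_width hK (θ := θ) ha hc
  have h5 := inner_sub_le_width hK (θ := θ) hc hb
  have h6 := inner_sub_le_width hK (θ := θ) hb hc
  rw [← hW] at h1 h2 h3 h4 h5 h6
  have e : θ - (φ + Real.pi / 3) = (θ - φ) - Real.pi / 3 := by ring
  simp only [inner_sub_right, inner_add_right, inner_smul_right, inner_direction_direction, e]
    at h1 h2 h3 h4 h5 h6
  rw [Real.cos_sub (θ - φ), Real.cos_pi_div_three, Real.sin_pi_div_three] at h3 h4 h5 h6
  have h7 := Real.cos_sq_add_sin_sq (θ - φ)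
  set r := Real.sqrt 3 with hr
  have hr2 : r ^ 2 = 3 := Real.sq_sqrt (by norm_num)
  have hr0 : 0 ≤ r := Real.sqrt_nonneg 3
  set x := s * Real.cos (θ - φ) with hx
  set z := s * (Real.cos (θ - φ) * (1 / 2) + Real.sin (θ - φ) * (r / 2)) - x with hz
  have hsum : x ^ 2 + z ^ 2 + (x + z) ^ 2 = 3 / 2 * s ^ 2 := by
    have : x + z = s * (Real.cos (θ - φ) * (1 / 2) + Real.sin (θ - φ) * (r / 2)) := by
      rw [hz]; ring
    rw [this, hz, hx]
    linear_combination (3 / 2 * s ^ 2) * h7 + (s ^ 2 * Real.sin (θ - φ) ^ 2 / 2) * hr2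
  have hW0 : 0 ≤ W := by linarith
  have b1 : x ^ 2 ≤ W ^ 2 := sq_le_sq' (by linarith) (by linarith)
  have b2 : z ^ 2 ≤ W ^ 2 := sq_le_sq' (by linarith) (by linarith)
  have b3 : (x + z) ^ 2 ≤ W ^ 2 := sq_le_sq' (by linarith) (by linarith)
  have key : 3 / 4 * s ^ 2 ≤ W ^ 2 := by
    rcases le_total 0 (x * z) with h | h
    · nlinarith
    · rcases le_total 0 (x * (x + z)) with h' | h'
      · nlinarith
      · nlinarith
  refine le_of_sq_le_sq ?_ hW0
  calc (r / 2 * s) ^ 2 = r ^ 2 / 4 * s ^ 2 := by ring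
    _ ≤ W ^ 2 := by rw [hr2]; exact key

theorem cos_neg_pi_div_two_sub_pi_div_three : Real.cos (-(Real.pi / 2) - Real.pi / 3)
    = -(Real.sqrt 3 / 2) := by
  rw [show -(Real.pi / 2) - Real.pi / 3 = -(Real.pi / 3 + Real.pi / 2) by ring, Real.cos_neg,
    Real.cos_add_pi_div_two, Real.sin_pi_div_three]

theorem width_equilateralRegion_le (a : Plane) {s : ℝ} (hs : 0 ≤ s) (φ : ℝ) :
    width (equilateralRegion a s φ) (φ - Real.pi / 2) ≤ Real.sqrt 3 / 2 * s := by
  set u := direction (φ - Real.pi / 2) with hu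
  have e1 : inner ℝ u (direction φ) = 0 := by
    rw [hu, inner_direction_direction,
      show φ - Real.pi / 2 - φ = -(Real.pi / 2) by ring, Real.cos_neg, Real.cos_pi_div_two]
  have e2 : inner ℝ u (direction (φ + Real.pi / 3)) = -(Real.sqrt 3 / 2) := by
    rw [hu, inner_direction_direction,
      show φ - Real.pi / 2 - (φ + Real.pi / 3) = -(Real.pi / 2) - Real.pi / 3 by ring,
      cos_neg_pi_div_two_sub_pi_div_three]
  have h := width_le (K := equilateralRegion a s φ) (θ := φ - Real.pi / 2)
    (m := inner ℝ u a - Real.sqrt 3 / 2 * s) (M := inner ℝ u a)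
    ⟨a, subset_convexHull ℝ _ (by simp)⟩ (fun x hx => by
      have hp : 0 ≤ Real.sqrt 3 / 2 * s := by positivity
      constructor
      · refine le_inner_of_mem_convexHull ?_ hx
        rintro y (rfl | rfl | rfl) <;>
          simp only [← hu, inner_add_right, inner_smul_right, e1, e2] <;> linarith
      · refine inner_le_of_mem_convexHull ?_ hx
        rintro y (rfl | rfl | rfl) <;>
          simp only [← hu, inner_add_right, inner_smul_right, e1, e2] <;> linarith)
  linarith

/-- The three directions are the outward side normals. The functionals are maximal at `a` for the
sides through `a`, and the opposite side adds the height; the contributions of `a` itself cancel. -/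
theorem sum_inner_le_of_mem_equilateralRegion (a : Plane) {s : ℝ} (hs : 0 ≤ s) (φ : ℝ)
    {x y z : Plane} (hx : x ∈ equilateralRegion a s φ) (hy : y ∈ equilateralRegion a s φ)
    (hz : z ∈ equilateralRegion a s φ) :
    inner ℝ (direction (φ - Real.pi / 2)) x
      + inner ℝ (direction (φ - Real.pi / 2 + 2 * Real.pi / 3)) y
      + inner ℝ (direction (φ - Real.pi / 2 + 2 * (2 * Real.pi / 3))) z
      ≤ Real.sqrt 3 / 2 * s := by
  have c6 := Real.cos_pi_div_six
  have hp : 0 ≤ Real.sqrt 3 / 2 * s := by positivity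
  have x0 : inner ℝ (direction (φ - Real.pi / 2)) (direction φ) = 0 := by
    rw [inner_direction_direction,
      show φ - Real.pi / 2 - φ = -(Real.pi / 2) by ring, Real.cos_neg, Real.cos_pi_div_two]
  have x1 : inner ℝ (direction (φ - Real.pi / 2)) (direction (φ + Real.pi / 3))
      = -(Real.sqrt 3 / 2) := by
    rw [inner_direction_direction,
      show φ - Real.pi / 2 - (φ + Real.pi / 3) = -(Real.pi / 2) - Real.pi / 3 by ring,
      cos_neg_pi_div_two_sub_pi_div_three]
  have y0 : inner ℝ (direction (φ - Real.pi / 2 + 2 * Real.pi / 3)) (direction φ)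
      = Real.sqrt 3 / 2 := by
    rw [inner_direction_direction, ← c6]; congr 1; ring
  have y1 : inner ℝ (direction (φ - Real.pi / 2 + 2 * Real.pi / 3))
      (direction (φ + Real.pi / 3)) = Real.sqrt 3 / 2 := by
    rw [inner_direction_direction, ← c6, ← Real.cos_neg]; congr 1; ring
  have z0 : inner ℝ (direction (φ - Real.pi / 2 + 2 * (2 * Real.pi / 3))) (direction φ)
      = -(Real.sqrt 3 / 2) := by
    rw [inner_direction_direction, ← c6, ← Real.cos_pi_sub, ← Real.cos_neg]
    rw [← Real.cos_neg]; congr 1; ring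
  have z1 : inner ℝ (direction (φ - Real.pi / 2 + 2 * (2 * Real.pi / 3)))
      (direction (φ + Real.pi / 3)) = 0 := by
    rw [inner_direction_direction, ← Real.cos_pi_div_two]; congr 1; ring
  have hX : inner ℝ (direction (φ - Real.pi / 2)) x ≤ inner ℝ (direction (φ - Real.pi / 2)) a := by
    refine inner_le_of_mem_convexHull ?_ hx
    rintro w (rfl | rfl | rfl) <;>
      (try simp only [inner_add_right, inner_smul_right, x0, x1]) <;> linarith
  have hY : inner ℝ (direction (φ - Real.pi / 2 + 2 * Real.pi / 3)) y
      ≤ inner ℝ (direction (φ - Real.pi / 2 + 2 * Real.pi / 3)) a + Real.sqrt 3 / 2 * s := by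
    refine inner_le_of_mem_convexHull ?_ hy
    rintro w (rfl | rfl | rfl) <;>
      (try simp only [inner_add_right, inner_smul_right, y0, y1]) <;> linarith
  have hZ : inner ℝ (direction (φ - Real.pi / 2 + 2 * (2 * Real.pi / 3))) z
      ≤ inner ℝ (direction (φ - Real.pi / 2 + 2 * (2 * Real.pi / 3))) a := by
    refine inner_le_of_mem_convexHull ?_ hz
    rintro w (rfl | rfl | rfl) <;>
      (try simp only [inner_add_right, inner_smul_right, z0, z1]) <;> linarith
  have h0 := sum_inner_direction_eq_zero (φ - Real.pi / 2) (N := 3) (δ := 2 * Real.pi / 3)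
      (by push_cast; ring) (by positivity) (by linarith [Real.pi_pos]) a
  simp only [Finset.sum_range_succ, Finset.sum_range_zero, Nat.cast_zero, Nat.cast_one,
      zero_mul, add_zero, zero_add, one_mul, Nat.cast_ofNat] at h0
  linarith

theorem triangleRegion_eq_equilateralRegion {t : Affine.Triangle ℝ Plane} (ht : t.Equilateral) :
    ∃ a s φ, 0 < s ∧ triangleRegion t = equilateralRegion a s φ := by
  obtain ⟨s, hs⟩ := ht
  have hrange : Set.range t.points = {t.points 0, t.points 1, t.points 2} := by
    ext x
    simp [Fin.exists_fin_succ, eq_comm]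
  have d1 := hs 1 0 (by decide)
  have d2 := hs 2 0 (by decide)
  have d3 := hs 2 1 (by decide)
  have hs0 : 0 < s := by
    rw [← d1, dist_pos]
    exact t.independent.injective.ne (by decide)
  unfold triangleRegion
  rw [hrange]
  generalize t.points 0 = a at *
  obtain ⟨v, hv⟩ : ∃ v, t.points 1 = a + v := ⟨t.points 1 - a, by abel⟩
  obtain ⟨w, hw⟩ : ∃ w, t.points 2 = a + w := ⟨t.points 2 - a, by abel⟩
  rw [hv] at d1 d3 ⊢
  rw [hw] at d2 d3 ⊢
  rw [dist_eq_norm, add_sub_cancel_left] at d1 d2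
  rw [dist_eq_norm, add_sub_add_left_eq_sub] at d3
  obtain ⟨φ, hφ⟩ := exists_direction_eq (u := s⁻¹ • v) (by
    rw [norm_smul, d1, norm_inv, Real.norm_of_nonneg hs0.le, inv_mul_cancel₀ hs0.ne'])
  have hv' : v = s • direction φ := by rw [hφ, smul_inv_smul₀ hs0.ne']
  subst hv'
  have n2 := norm_sq_plane w
  have n3 := norm_sq_plane (w - s • direction φ)
  rw [d2] at n2
  rw [d3] at n3
  simp only [PiLp.sub_apply, PiLp.smul_apply, smul_eq_mul, direction_zero_apply,
    direction_one_apply] at n3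
  set α := w 0 * Real.cos φ + w 1 * Real.sin φ with hα
  set β := -w 0 * Real.sin φ + w 1 * Real.cos φ with hβ
  have hp := Real.cos_sq_add_sin_sq φ
  have w0 : w 0 = α * Real.cos φ - β * Real.sin φ := by
    rw [hα, hβ]; linear_combination (-w 0) * hp
  have w1 : w 1 = α * Real.sin φ + β * Real.cos φ := by
    rw [hα, hβ]; linear_combination (-w 1) * hp
  have hα2 : α = s / 2 := by
    have : 2 * s * α = s * s := by rw [hα]; linear_combination n3 - n2 + s ^ 2 * hp
    have : s * (2 * α - s) = 0 := by linarith
    rcases mul_eq_zero.1 this with h | h <;> linarith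
  have hβ2 : β ^ 2 = (Real.sqrt 3 / 2 * s) ^ 2 := by
    have h3 : Real.sqrt 3 ^ 2 = 3 := Real.sq_sqrt (by norm_num)
    have h4 : s ^ 2 = α ^ 2 + β ^ 2 := by
      rw [hα, hβ]; linear_combination n2 + (-(w 0 ^ 2) - w 1 ^ 2) * hp
    rw [hα2] at h4
    rw [mul_pow, div_pow, h3]; linarith
  -- The third vertex lies on one side of the first edge or the other. In the clockwise case the
  -- roles of the two edges at `a` are exchanged.
  rcases sq_eq_sq_iff_eq_or_eq_neg.1 hβ2 with h | h
  · refine ⟨a, s, φ, hs0, ?_⟩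
    have : w = s • direction (φ + Real.pi / 3) := by
      apply plane_ext
      · simp only [PiLp.smul_apply, smul_eq_mul, direction_zero_apply, Real.cos_add,
          Real.cos_pi_div_three, Real.sin_pi_div_three]
        rw [w0, hα2, h]; ring
      · simp only [PiLp.smul_apply, smul_eq_mul, direction_one_apply, Real.sin_add,
          Real.cos_pi_div_three, Real.sin_pi_div_three]
        rw [w1, hα2, h]; ring
    rw [this, equilateralRegion]
  · refine ⟨a, s, φ - Real.pi / 3, hs0, ?_⟩
    have : w = s • direction (φ - Real.pi / 3) := by
      apply plane_ext
      · simp only [PiLp.smul_apply, smul_eq_mul, direction_zero_apply, Real.cos_sub,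
          Real.cos_pi_div_three, Real.sin_pi_div_three]
        rw [w0, hα2, h]; ring
      · simp only [PiLp.smul_apply, smul_eq_mul, direction_one_apply, Real.sin_sub,
          Real.cos_pi_div_three, Real.sin_pi_div_three]
        rw [w1, hα2, h]; ring
    rw [this, equilateralRegion, sub_add_cancel]
    congr 2
    exact Set.pair_comm _ _

/-- The Cheeger constant of an equilateral triangle of width one is at least `1 / t`, where `t` is
the positive root of `(1 - 3 t)² = √3 π t²`. -/
theorem ofReal_le_cheegerConstant_triangle {T : Affine.Triangle ℝ Plane} (hT : T.Equilateral)
    (hw : HasWidth (triangleRegion T) 1) {t : ℝ} (ht0 : 0 < t)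
    (ht : (1 - 3 * t) ^ 2 = Real.sqrt 3 * Real.pi * t ^ 2) :
    ENNReal.ofReal (1 / t) ≤ cheegerConstant (triangleRegion T) := by
  obtain ⟨a, s, φ, hs, e⟩ := triangleRegion_eq_equilateralRegion hT
  rw [e] at hw ⊢
  obtain ⟨θ, hθ⟩ := hw.1
  have h1 := le_width_equilateralRegion a s φ θ
  rw [hθ] at h1
  exact ofReal_le_cheegerConstant (isCompact_equilateralRegion a s φ) ht0 ht (φ - Real.pi / 2)
    fun x hx y hy z hz => (sum_inner_le_of_mem_equilateralRegion a hs.le φ hx hy hz).trans h1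

theorem exists_equilateral_hasWidth_one :
    ∃ t : Affine.Triangle ℝ Plane, t.Equilateral ∧ HasWidth (triangleRegion t) 1 := by
  set s := 2 / Real.sqrt 3 with hs
  have hs0 : 0 < s := by positivity
  have h3 : Real.sqrt 3 / 2 * s = 1 := by rw [hs]; field_simp
  have hind : AffineIndependent ℝ ![(0 : Plane), s • direction 0, s • direction (Real.pi / 3)] := by
    rw [affineIndependent_iff_not_collinear_set, collinear_iff_of_mem (p₀ := (0 : Plane)) (by simp)]
    rintro ⟨v, hv⟩
    obtain ⟨p, hp⟩ := hv (s • direction 0) (by simp)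
    obtain ⟨q, hq⟩ := hv (s • direction (Real.pi / 3)) (by simp)
    have p0 := congrArg (fun x : Plane => x 0) hp
    have p1 := congrArg (fun x : Plane => x 1) hp
    have q1 := congrArg (fun x : Plane => x 1) hq
    simp [Real.sin_pi_div_three] at p0 p1 q1
    rcases p1 with h | h
    · rw [h] at p0; simp at p0; linarith
    · rw [h] at q1
      have : 0 < s * (Real.sqrt 3 / 2) := by positivity
      simp at q1
      exact hs0.ne' q1
  have hd : ∀ φ ψ : ℝ, dist (s • direction φ) (s • direction ψ) ^ 2
      = s ^ 2 * (2 - 2 * Real.cos (φ - ψ)) := by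
    intro φ ψ
    rw [dist_eq_norm, norm_sq_plane, Real.cos_sub]
    simp only [PiLp.sub_apply, PiLp.smul_apply, smul_eq_mul, direction_zero_apply,
      direction_one_apply]
    linear_combination s ^ 2 * Real.cos_sq_add_sin_sq φ + s ^ 2 * Real.cos_sq_add_sin_sq ψ
  have hd1 : dist (s • direction 0) (s • direction (Real.pi / 3)) = s := by
    have h := hd 0 (Real.pi / 3)
    rw [zero_sub, Real.cos_neg, Real.cos_pi_div_three] at h
    exact (sq_eq_sq₀ dist_nonneg hs0.le).1 (by rw [h]; ring)
  have hn : ∀ φ, ‖s • direction φ‖ = s := fun φ => by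
    rw [norm_smul, norm_direction, Real.norm_of_nonneg hs0.le, mul_one]
  refine ⟨⟨_, hind⟩, ⟨s, ?_⟩, ?_⟩
  · intro i j hij
    fin_cases i <;> fin_cases j <;> simp [hn, hd1, dist_comm (s • direction (Real.pi / 3))] at hij ⊢
  · have hreg : triangleRegion ⟨_, hind⟩ = equilateralRegion 0 s 0 := by
      unfold triangleRegion equilateralRegion
      simp [Matrix.range_cons]
      congr 1
      ext x
      simp only [Set.mem_insert_iff, Set.mem_singleton_iff]
      tauto
    rw [hreg]
    refine ⟨⟨0 - Real.pi / 2, le_antisymm ?_ ?_⟩, ?_⟩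
    · exact (width_equilateralRegion_le 0 hs0.le 0).trans_eq h3
    · exact h3.symm.le.trans (le_width_equilateralRegion 0 s 0 _)
    · rintro _ ⟨θ, rfl⟩
      exact h3.symm.le.trans (le_width_equilateralRegion 0 s 0 θ)

/-! ### Perimeter of a rounded triangle from above -/

theorem lipschitzWith_direction : LipschitzWith 1 direction := by
  refine LipschitzWith.of_dist_le_mul fun x y => ?_
  rw [NNReal.coe_one, one_mul, dist_eq_norm, Real.dist_eq]
  refine le_of_sq_le_sq ?_ (abs_nonneg _)
  rw [norm_sq_plane, sq_abs]
  have h := Real.one_sub_sq_div_two_le_cos (x := x - y)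
  rw [Real.cos_sub] at h
  have h1 := Real.cos_sq_add_sin_sq x
  have h2 := Real.cos_sq_add_sin_sq y
  simp only [PiLp.sub_apply, direction_zero_apply, direction_one_apply]
  nlinarith

theorem hausdorffMeasure_sphere_le {t : ℝ} (ht : 0 < t) :
    μH[1] (Metric.sphere (0 : Plane) t) ≤ ENNReal.ofReal (2 * Real.pi * t) := by
  have hsub : Metric.sphere (0 : Plane) t
      ⊆ (fun θ : ℝ => t • direction θ) '' Set.Icc 0 (2 * Real.pi) := by
    intro y hy
    rw [mem_sphere_zero_iff_norm] at hy
    obtain ⟨θ, hθ⟩ := exists_direction_eq (u := t⁻¹ • y) (by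
      rw [norm_smul, hy, norm_inv, Real.norm_of_nonneg ht.le, inv_mul_cancel₀ ht.ne'])
    have hper : Function.Periodic direction (2 * Real.pi) := direction_add_two_pi
    obtain ⟨ψ, hψ, e⟩ := hper.exists_mem_Ico₀ Real.two_pi_pos θ
    exact ⟨ψ, ⟨hψ.1, hψ.2.le⟩, by simp only [← e, hθ, smul_inv_smul₀ ht.ne']⟩
  have hl : LipschitzWith (Real.toNNReal t) fun θ : ℝ => t • direction θ := by
    refine LipschitzWith.of_dist_le_mul fun x y => ?_
    rw [dist_smul₀, Real.norm_of_nonneg ht.le, Real.coe_toNNReal _ ht.le]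
    have := lipschitzWith_direction.dist_le_mul x y
    rw [NNReal.coe_one, one_mul] at this
    gcongr
  calc _ ≤ _ := measure_mono hsub
    _ ≤ _ := hl.hausdorffMeasure_image_le zero_le_one _
    _ = _ := by
      rw [hausdorffMeasure_real, Real.volume_Icc, ENNReal.rpow_one, sub_zero, ENNReal.ofReal,
        ENNReal.ofReal, ← ENNReal.coe_mul, ← Real.toNNReal_mul ht.le, mul_comm]

theorem hausdorffMeasure_add_image_le (a : Plane) (S : Set Plane) :
    μH[1] ((fun y => a + y) '' S) ≤ μH[1] S := by
  have h := (isometry_add_left a).lipschitz.hausdorffMeasure_image_le zero_le_one S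
  rwa [ENNReal.coe_one, ENNReal.one_rpow, one_mul] at h

theorem eq_zero_of_inner_eq_zero {v w y : Plane} (h : cross v w ≠ 0) (hv : inner ℝ y v = 0)
    (hw : inner ℝ y w = 0) : y = 0 := by
  rw [inner_plane] at hv hw
  unfold cross at h
  apply plane_ext
  · refine mul_right_cancel₀ h ?_
    simp only [PiLp.zero_apply]; linear_combination w 1 * hv - v 1 * hw
  · refine mul_right_cancel₀ h ?_
    simp only [PiLp.zero_apply]; linear_combination v 0 * hw - w 0 * hv

/-- The unit normal to `d`, pointing to the right of `d`. -/
noncomputable def rightNormal (d : Plane) : Plane := ‖d‖⁻¹ • !₂[d 1, -d 0]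

theorem norm_rightNormal {d : Plane} (hd : d ≠ 0) : ‖rightNormal d‖ = 1 := by
  have h1 : ‖(!₂[d 1, -d 0] : Plane)‖ = ‖d‖ := by
    rw [← sq_eq_sq₀ (norm_nonneg _) (norm_nonneg _), norm_sq_plane, norm_sq_plane]
    simp; ring
  rw [rightNormal, norm_smul, h1, norm_inv, norm_norm, inv_mul_cancel₀ (norm_ne_zero_iff.2 hd)]

theorem inner_rightNormal (d e : Plane) : inner ℝ (rightNormal d) e = -(‖d‖⁻¹ * cross d e) := by
  rw [rightNormal, inner_smul_left, inner_plane]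
  simp [cross]; ring

theorem inner_rightNormal_self (d : Plane) : inner ℝ (rightNormal d) d = 0 := by
  rw [inner_rightNormal, cross]; ring

theorem cross_rightNormal {d : Plane} (hd : d ≠ 0) : cross d (rightNormal d) = -‖d‖ := by
  have h := norm_sq_plane d
  have h0 : ‖d‖ ≠ 0 := norm_ne_zero_iff.2 hd
  simp only [cross, rightNormal, PiLp.smul_apply, smul_eq_mul]
  simp
  field_simp
  linarith

theorem eq_smul_rightNormal {d e y : Plane} (hde : 0 < cross d e) (h : inner ℝ y d = 0)
    (h' : inner ℝ y e ≤ 0) : y = ‖y‖ • rightNormal d := by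
  have hd : d ≠ 0 := by rintro rfl; simp [cross] at hde
  have h0 : 0 < ‖d‖ := norm_pos_iff.2 hd
  set k := inner ℝ y (rightNormal d) with hk
  have hy : y - k • rightNormal d = 0 := by
    refine eq_zero_of_inner_eq_zero (v := d) (w := rightNormal d) ?_ ?_ ?_
    · rw [cross_rightNormal hd]; exact neg_ne_zero.2 h0.ne'
    · rw [inner_sub_left, h, inner_smul_left, inner_rightNormal_self]; simp
    · rw [inner_sub_left, inner_smul_left, real_inner_self_eq_norm_sq, norm_rightNormal hd, hk]
      simp
  have hy' : y = k • rightNormal d := sub_eq_zero.1 hy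
  have hk0 : 0 ≤ k := by
    rw [hy', inner_smul_left, inner_rightNormal] at h'
    have : 0 < ‖d‖⁻¹ * cross d e := by positivity
    simp only [conj_trivial] at h'
    nlinarith
  have hn : ‖y‖ = k := by
    rw [hy', norm_smul, norm_rightNormal hd, Real.norm_of_nonneg hk0, mul_one]
  rw [hn]; exact hy'

theorem cross_rotate (a b c : Plane) : cross (c - b) (a - b) = cross (b - a) (c - a) := by
  simp only [cross, PiLp.sub_apply]; ring

theorem mem_convexHull_triple {a b c x : Plane} :
    x ∈ convexHull ℝ {a, b, c} ↔
      ∃ α β γ : ℝ, 0 ≤ α ∧ 0 ≤ β ∧ 0 ≤ γ ∧ α + β + γ = 1 ∧ α • a + β • b + γ • c = x := by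
  constructor
  · intro h
    rw [convexHull_insert (by simp), convexHull_pair, convexJoin_singleton_left] at h
    simp only [Set.mem_iUnion] at h
    obtain ⟨y, ⟨p, q, hp, hq, hpq, rfl⟩, r, s, hr, hs, hrs, rfl⟩ := h
    refine ⟨r, s * p, s * q, hr, by positivity, by positivity, ?_, ?_⟩
    · linear_combination hrs + s * hpq
    · module
  · rintro ⟨α, β, γ, hα, hβ, hγ, h1, rfl⟩
    have hc := convex_convexHull ℝ ({a, b, c} : Set Plane)
    have := hc.sum_mem (t := Finset.univ) (w := ![α, β, γ]) (z := ![a, b, c])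
      (by intro i _; fin_cases i <;> simp [hα, hβ, hγ])
      (by simp [Fin.sum_univ_three, h1])
      (by intro i _; fin_cases i <;> exact subset_convexHull ℝ _ (by simp))
    simpa [Fin.sum_univ_three] using this

open scoped Pointwise in
/-- The points at distance at most `t` from the triangle with vertices `a`, `b`, `c`. -/
def roundedTriangle (a b c : Plane) (t : ℝ) : Set Plane :=
  convexHull ℝ {a, b, c} + Metric.closedBall (0 : Plane) t

theorem convex_roundedTriangle (a b c : Plane) (t : ℝ) : Convex ℝ (roundedTriangle a b c t) :=
  (convex_convexHull ℝ _).add (convex_closedBall 0 t)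

/-- The translates to the origin of the open circular arcs in the boundary of a rounded triangle. -/
def openArc (a b c : Plane) (t : ℝ) : Set Plane :=
  Metric.sphere 0 t ∩ {y | inner ℝ y (b - a) < 0 ∧ inner ℝ y (c - a) < 0}

theorem measurableSet_openArc (a b c : Plane) (t : ℝ) : MeasurableSet (openArc a b c t) := by
  refine Metric.isClosed_sphere.measurableSet.inter (IsOpen.measurableSet ?_)
  exact (isOpen_lt (f := fun y : Plane => inner ℝ y (b - a)) (by fun_prop) continuous_const).inter
    (isOpen_lt (f := fun y : Plane => inner ℝ y (c - a)) (by fun_prop) continuous_const)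

/-- A vector lies in the arc of a vertex only if that vertex is its unique maximiser among the
three, so the arcs are disjoint parts of one circle. -/
theorem sum_hausdorffMeasure_openArc_le (a b c : Plane) {t : ℝ} (ht : 0 < t) :
    μH[1] (openArc a b c t) + μH[1] (openArc b c a t) + μH[1] (openArc c a b t)
      ≤ ENNReal.ofReal (2 * Real.pi * t) := by
  have hneg : ∀ y p q : Plane, inner ℝ y (p - q) = -inner ℝ y (q - p) := by
    intro y p q; rw [← inner_neg_right, neg_sub]
  have d1 : Disjoint (openArc a b c t) (openArc b c a t) := by
    refine Set.disjoint_left.2 fun y h h' => ?_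
    have := h.2.1; have h2 := h'.2.2; rw [hneg] at h2; linarith
  have d2 : Disjoint (openArc a b c t ∪ openArc b c a t) (openArc c a b t) := by
    refine Set.disjoint_left.2 fun y h h' => ?_
    rcases h with h | h
    · have := h.2.2; have h2 := h'.2.1; rw [hneg] at h2; linarith
    · have := h.2.1; have h2 := h'.2.2; rw [hneg] at h2; linarith
  rw [← measure_union d1 (measurableSet_openArc _ _ _ _),
    ← measure_union d2 (measurableSet_openArc _ _ _ _)]
  refine (measure_mono ?_).trans (hausdorffMeasure_sphere_le ht)
  rintro y ((h | h) | h) <;> exact h.1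

theorem exists_nearest {K : Set Plane} (hK : IsCompact K) (hc : Convex ℝ K) (hne : K.Nonempty)
    (x : Plane) : ∃ p ∈ K, (∀ z ∈ K, inner ℝ (x - p) (z - p) ≤ 0) ∧ ∀ z ∈ K, ‖x - p‖ ≤ ‖x - z‖ := by
  obtain ⟨p, hp, hmin⟩ := hK.exists_isMinOn hne (f := fun z => ‖x - z‖) (by fun_prop)
  have hinf : ‖x - p‖ = ⨅ w : K, ‖x - w‖ := by
    have : Nonempty K := hne.to_subtype
    refine le_antisymm (le_ciInf fun w => hmin w.2) ?_
    exact ciInf_le ⟨0, by rintro _ ⟨w, rfl⟩; exact norm_nonneg _⟩ (⟨p, hp⟩ : K)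
  exact ⟨p, hp, (norm_eq_iInf_iff_real_inner_le_zero hc hp).1 hinf, fun z hz => hmin hz⟩

/-- A frontier point is `p + y` with `p` its nearest point in the triangle, `‖y‖ = t` and `y` normal
at `p`. Whether `p` lies on a side or at a vertex decides between a translated side and an arc. -/
theorem frontier_roundedTriangle_subset {a b c : Plane} {t : ℝ} (ht : 0 < t)
    (h : 0 < cross (b - a) (c - a)) :
    frontier (roundedTriangle a b c t) ⊆
      ((fun y => t • rightNormal (b - a) + y) '' segment ℝ a b ∪
      (fun y => t • rightNormal (c - b) + y) '' segment ℝ b c ∪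
      (fun y => t • rightNormal (a - c) + y) '' segment ℝ c a) ∪
      ((fun y => a + y) '' openArc a b c t ∪ (fun y => b + y) '' openArc b c a t ∪
      (fun y => c + y) '' openArc c a b t) := by
  intro x hx
  have hcpt : IsCompact (convexHull ℝ {a, b, c}) := Set.Finite.isCompact_convexHull ℝ (by simp)
  have hEc : IsClosed (roundedTriangle a b c t) :=
    (hcpt.add (isCompact_closedBall 0 t)).isClosed
  have hxE : x ∈ roundedTriangle a b c t := hEc.frontier_subset hx
  obtain ⟨p, hp, hN, hmin⟩ := exists_nearest hcpt (convex_convexHull ℝ _)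
    ⟨a, subset_convexHull ℝ _ (by simp)⟩ x
  obtain ⟨y, rfl⟩ : ∃ y, x = p + y := ⟨x - p, by abel⟩
  simp only [add_sub_cancel_left] at hN hmin
  have hy : ‖y‖ = t := by
    refine le_antisymm ?_ ?_
    · obtain ⟨p', hp', y', hy', e⟩ := hxE
      refine (hmin p' hp').trans ?_
      rw [← e]; simpa using hy'
    · by_contra hlt
      push Not at hlt
      refine hx.2 (mem_interior.2 ⟨Metric.ball (p + y) (t - ‖y‖), ?_, Metric.isOpen_ball,
        Metric.mem_ball_self (by linarith)⟩)
      intro z hz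
      refine ⟨p, hp, z - p, ?_, by simp⟩
      rw [mem_closedBall_zero_iff]
      rw [mem_ball_iff_norm] at hz
      calc ‖z - p‖ = ‖(z - (p + y)) + y‖ := by congr 1; abel
        _ ≤ ‖z - (p + y)‖ + ‖y‖ := norm_add_le _ _
        _ ≤ t := by linarith
  have ha := hN a (subset_convexHull ℝ _ (by simp))
  have hb := hN b (subset_convexHull ℝ _ (by simp))
  have hc := hN c (subset_convexHull ℝ _ (by simp))
  obtain ⟨α, β, γ, hα, hβ, hγ, hs, rfl⟩ := mem_convexHull_triple.1 hp
  set p := α • a + β • b + γ • c with hpdef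
  -- Complementary slackness: nonpositive terms with zero sum all vanish, so any vertex of positive
  -- weight maximises `y`.
  have hsum : α * inner ℝ y (a - p) + β * inner ℝ y (b - p) + γ * inner ℝ y (c - p) = 0 := by
    have : α • (a - p) + β • (b - p) + γ • (c - p) = 0 := by
      have : α • (a - p) + β • (b - p) + γ • (c - p) = p - (α + β + γ) • p := by
        rw [hpdef]; module
      rw [this, hs, one_smul, sub_self]
    rw [← inner_smul_right, ← inner_smul_right, ← inner_smul_right, ← inner_add_right,
      ← inner_add_right, this, inner_zero_right]
  have m1 := mul_nonpos_of_nonneg_of_nonpos hα ha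
  have m2 := mul_nonpos_of_nonneg_of_nonpos hβ hb
  have m3 := mul_nonpos_of_nonneg_of_nonpos hγ hc
  have z1 : α * inner ℝ y (a - p) = 0 := by linarith
  have z2 : β * inner ℝ y (b - p) = 0 := by linarith
  have z3 : γ * inner ℝ y (c - p) = 0 := by linarith
  have hd : ∀ u v : Plane, inner ℝ y (u - v) = inner ℝ y (u - p) - inner ℝ y (v - p) := by
    intro u v; rw [← inner_sub_right]; congr 1; abel
  have h2 : 0 < cross (c - b) (a - b) := by rwa [cross_rotate]
  have h3 : 0 < cross (a - c) (b - c) := by rwa [cross_rotate b c a, cross_rotate]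
  have hy0 : y ≠ 0 := by rintro rfl; simp at hy; linarith
  -- Cases by which vertices maximise `y`: two give a side and one gives an arc; three would force
  -- `y = 0`, and none would force all weights to vanish.
  rcases eq_or_ne (inner ℝ y (a - p)) 0 with ea | ea <;>
  rcases eq_or_ne (inner ℝ y (b - p)) 0 with eb | eb <;>
  rcases eq_or_ne (inner ℝ y (c - p)) 0 with ec | ec
  · exact absurd (eq_zero_of_inner_eq_zero h.ne' (by rw [hd]; linarith) (by rw [hd]; linarith)) hy0
  · left; left; left
    have e : γ = 0 := (mul_eq_zero.1 z3).resolve_right ec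
    have n := eq_smul_rightNormal h (y := y) (by rw [hd]; linarith) (by rw [hd]; linarith)
    rw [hy] at n
    exact ⟨p, ⟨α, β, hα, hβ, by linarith, by rw [hpdef, e]; module⟩, by
      simp only [← n]; abel⟩
  · left; right
    have e : β = 0 := (mul_eq_zero.1 z2).resolve_right eb
    have n := eq_smul_rightNormal h3 (y := y) (by rw [hd]; linarith) (by rw [hd]; linarith)
    rw [hy] at n
    exact ⟨p, ⟨γ, α, hγ, hα, by linarith, by rw [hpdef, e]; module⟩, by
      simp only [← n]; abel⟩
  · right; left; left
    have e : β = 0 := (mul_eq_zero.1 z2).resolve_right eb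
    have e' : γ = 0 := (mul_eq_zero.1 z3).resolve_right ec
    have e'' : α = 1 := by linarith
    refine ⟨y, ⟨by simpa using hy, ?_, ?_⟩, by simp [hpdef, e, e', e'']⟩
    · rw [hd, ea, sub_zero]; exact lt_of_le_of_ne hb eb
    · rw [hd, ea, sub_zero]; exact lt_of_le_of_ne hc ec
  · left; left; right
    have e : α = 0 := (mul_eq_zero.1 z1).resolve_right ea
    have n := eq_smul_rightNormal h2 (y := y) (by rw [hd]; linarith) (by rw [hd]; linarith)
    rw [hy] at n
    exact ⟨p, ⟨β, γ, hβ, hγ, by linarith, by rw [hpdef, e]; module⟩, by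
      simp only [← n]; abel⟩
  · right; left; right
    have e : α = 0 := (mul_eq_zero.1 z1).resolve_right ea
    have e' : γ = 0 := (mul_eq_zero.1 z3).resolve_right ec
    have e'' : β = 1 := by linarith
    refine ⟨y, ⟨by simpa using hy, ?_, ?_⟩, by simp [hpdef, e, e', e'']⟩
    · rw [hd, eb, sub_zero]; exact lt_of_le_of_ne hc ec
    · rw [hd, eb, sub_zero]; exact lt_of_le_of_ne ha ea
  · right; right
    have e : α = 0 := (mul_eq_zero.1 z1).resolve_right ea
    have e' : β = 0 := (mul_eq_zero.1 z2).resolve_right eb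
    have e'' : γ = 1 := by linarith
    refine ⟨y, ⟨by simpa using hy, ?_, ?_⟩, by simp [hpdef, e, e', e'']⟩
    · rw [hd, ec, sub_zero]; exact lt_of_le_of_ne ha ea
    · rw [hd, ec, sub_zero]; exact lt_of_le_of_ne hb eb
  · have e : α = 0 := (mul_eq_zero.1 z1).resolve_right ea
    have e' : β = 0 := (mul_eq_zero.1 z2).resolve_right eb
    have e'' : γ = 0 := (mul_eq_zero.1 z3).resolve_right ec
    linarith

theorem perimeter_roundedTriangle_le {a b c : Plane} {t : ℝ} (ht : 0 < t)
    (h : 0 < cross (b - a) (c - a)) :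
    perimeter (roundedTriangle a b c t)
      ≤ ENNReal.ofReal (‖b - a‖ + ‖c - b‖ + ‖a - c‖ + 2 * Real.pi * t) := by
  have hseg : ∀ p q v : Plane, μH[1] ((fun y => v + y) '' segment ℝ p q)
      ≤ ENNReal.ofReal ‖q - p‖ := by
    intro p q v
    refine (hausdorffMeasure_add_image_le _ _).trans_eq ?_
    rw [hausdorffMeasure_segment, edist_dist, dist_comm, dist_eq_norm]
  calc _ ≤ _ := measure_mono (frontier_roundedTriangle_subset ht h)
    _ ≤ (ENNReal.ofReal ‖b - a‖ + ENNReal.ofReal ‖c - b‖ + ENNReal.ofReal ‖a - c‖)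
        + (μH[1] (openArc a b c t) + μH[1] (openArc b c a t) + μH[1] (openArc c a b t)) := by
      refine (measure_union_le _ _).trans (add_le_add ?_ ?_)
      · refine (measure_union_le _ _).trans (add_le_add ?_ (hseg _ _ _))
        exact (measure_union_le _ _).trans (add_le_add (hseg _ _ _) (hseg _ _ _))
      · refine (measure_union_le _ _).trans (add_le_add ?_ (hausdorffMeasure_add_image_le _ _))
        exact (measure_union_le _ _).trans
          (add_le_add (hausdorffMeasure_add_image_le _ _) (hausdorffMeasure_add_image_le _ _))
    _ ≤ (ENNReal.ofReal ‖b - a‖ + ENNReal.ofReal ‖c - b‖ + ENNReal.ofReal ‖a - c‖)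
        + ENNReal.ofReal (2 * Real.pi * t) := by
      gcongr; exact sum_hausdorffMeasure_openArc_le a b c ht
    _ = _ := by
      rw [ENNReal.ofReal_add (by positivity) (by positivity),
        ENNReal.ofReal_add (by positivity) (by positivity),
        ENNReal.ofReal_add (by positivity) (by positivity)]

/-! ### Area of a rounded triangle from below -/

theorem cross_injective {v w : Plane} (h : cross v w ≠ 0) {p₀ p₁ q₀ q₁ : ℝ}
    (e : p₀ • v + p₁ • w = q₀ • v + q₁ • w) : p₀ = q₀ ∧ p₁ = q₁ := by
  have e0 := congrArg (fun x : Plane => x 0) e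
  have e1 := congrArg (fun x : Plane => x 1) e
  simp only [PiLp.add_apply, PiLp.smul_apply, smul_eq_mul] at e0 e1
  unfold cross at h
  constructor
  · refine mul_right_cancel₀ h ?_
    linear_combination w 1 * e0 - w 0 * e1
  · refine mul_right_cancel₀ h ?_
    linear_combination v 0 * e1 - v 1 * e0

theorem measurableSet_frame_image (O : Plane) {v w : Plane} (h : cross v w ≠ 0) {s : Set Plane}
    (hs : MeasurableSet s) :
    MeasurableSet ((fun p : Plane => O + (p 0 • v + p 1 • w)) '' s) := by
  refine hs.image_of_continuousOn_injOn (Continuous.continuousOn (by fun_prop)) ?_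
  intro p _ q _ e
  obtain ⟨h0, h1⟩ := cross_injective h (add_left_cancel e)
  exact plane_ext h0 h1

theorem measurableSet_unit_square :
    MeasurableSet {p : Plane | (0 < p 0 ∧ p 0 < 1) ∧ 0 < p 1 ∧ p 1 < 1} := by
  refine IsOpen.measurableSet ?_
  have h (i : Fin 2) : Continuous fun p : Plane => p i := by fun_prop
  exact ((isOpen_lt continuous_const (h 0)).inter (isOpen_lt (h 0) continuous_const)).inter
    ((isOpen_lt continuous_const (h 1)).inter (isOpen_lt (h 1) continuous_const))

theorem measurableSet_unit_triangle :
    MeasurableSet {p : Plane | 0 < p 0 ∧ 0 < p 1 ∧ p 0 + p 1 < 1} := by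
  refine IsOpen.measurableSet ?_
  have h (i : Fin 2) : Continuous fun p : Plane => p i := by fun_prop
  exact (isOpen_lt continuous_const (h 0)).inter ((isOpen_lt continuous_const (h 1)).inter
    (isOpen_lt ((h 0).add (h 1)) continuous_const))

/-- `x` lies in the normal cone, at distance at most `t`, of the point of the triangle `a b c` with
affine coordinates `β`, `γ` with respect to `b - a`, `c - a`. -/
structure ProjectsTo (a b c : Plane) (t : ℝ) (x : Plane) (β γ : ℝ) : Prop where
  nonneg_left : 0 ≤ β
  nonneg_right : 0 ≤ γ
  sum_le_one : β + γ ≤ 1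
  inner_le : ∀ z ∈ ({a, b, c} : Set Plane),
    inner ℝ (x - (a + β • (b - a) + γ • (c - a))) z
      ≤ inner ℝ (x - (a + β • (b - a) + γ • (c - a))) (a + β • (b - a) + γ • (c - a))
  norm_le : ‖x - (a + β • (b - a) + γ • (c - a))‖ ≤ t

namespace ProjectsTo

variable {a b c x : Plane} {t β γ β' γ' : ℝ}

theorem mem_convexHull (h : ProjectsTo a b c t x β γ) :
    a + β • (b - a) + γ • (c - a) ∈ convexHull ℝ {a, b, c} :=
  mem_convexHull_triple.2 ⟨1 - β - γ, β, γ, by linarith [h.sum_le_one], h.nonneg_left,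
    h.nonneg_right, by ring, by module⟩

theorem mem_roundedTriangle (h : ProjectsTo a b c t x β γ) : x ∈ roundedTriangle a b c t :=
  ⟨_, h.mem_convexHull, x - (a + β • (b - a) + γ • (c - a)),
    by simpa using h.norm_le, by simp⟩

/-- Normal cones are monotone: testing each foot against the other gives `‖p - q‖² ≤ 0`. -/
theorem unique (hcr : cross (b - a) (c - a) ≠ 0) (h : ProjectsTo a b c t x β γ)
    (h' : ProjectsTo a b c t x β' γ') : β = β' ∧ γ = γ' := by
  have h1 := inner_le_of_mem_convexHull h.inner_le h'.mem_convexHull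
  have h2 := inner_le_of_mem_convexHull h'.inner_le h.mem_convexHull
  set p := a + β • (b - a) + γ • (c - a) with hp
  set q := a + β' • (b - a) + γ' • (c - a) with hq
  have h3 : inner ℝ (p - q) (p - q) ≤ 0 := by
    simp only [inner_sub_left, inner_sub_right] at h1 h2 ⊢
    rw [real_inner_comm p q] at *
    linarith
  have h4 : p = q := sub_eq_zero.1 (by
    rw [real_inner_self_eq_norm_sq] at h3
    exact norm_eq_zero.1 (pow_eq_zero_iff two_ne_zero |>.1 (le_antisymm h3 (sq_nonneg _))))
  refine cross_injective hcr ?_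
  rw [hp, hq, add_assoc, add_assoc] at h4
  exact add_left_cancel h4

end ProjectsTo

/-- The translate to the origin of the sector cut out of the rounded triangle at the vertex `a`. -/
def closedSector (a b c : Plane) (t : ℝ) : Set Plane :=
  Metric.closedBall 0 t ∩ {y | inner ℝ y (b - a) ≤ 0 ∧ inner ℝ y (c - a) ≤ 0}

theorem isClosed_closedSector (a b c : Plane) (t : ℝ) : IsClosed (closedSector a b c t) := by
  refine Metric.isClosed_closedBall.inter ?_
  exact (isClosed_le (f := fun y : Plane => inner ℝ y (b - a)) (by fun_prop) continuous_const).inter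
    (isClosed_le (f := fun y : Plane => inner ℝ y (c - a)) (by fun_prop) continuous_const)

/-- Every vector is maximised at some vertex, so the three sectors cover the disc. -/
theorem volume_closedBall_le_sum_closedSector (a b c : Plane) (t : ℝ) :
    volume (Metric.closedBall (0 : Plane) t) ≤ volume (closedSector a b c t)
      + volume (closedSector b c a t) + volume (closedSector c a b t) := by
  refine (measure_mono ?_).trans ((measure_union_le _ _).trans
    (add_le_add (measure_union_le _ _) le_rfl))
  intro y hy
  simp only [closedSector, Set.mem_union, Set.mem_inter_iff, Set.mem_ofPred_eq, inner_sub_right]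
  rcases le_total (inner ℝ y a) (inner ℝ y b) with h1 | h1 <;>
  rcases le_total (inner ℝ y b) (inner ℝ y c) with h2 | h2 <;>
  rcases le_total (inner ℝ y c) (inner ℝ y a) with h3 | h3
  all_goals
    first
    | (left; left; exact ⟨hy, by linarith, by linarith⟩)
    | (left; right; exact ⟨hy, by linarith, by linarith⟩)
    | (right; exact ⟨hy, by linarith, by linarith⟩)

/-- The open rectangle of height `t` erected over the segment from `a` to `b`, to its right. -/
def sideRectangle (a b : Plane) (t : ℝ) : Set Plane :=
  (fun p : Plane => a + (p 0 • (b - a) + p 1 • (t • rightNormal (b - a)))) ''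
    {p : Plane | (0 < p 0 ∧ p 0 < 1) ∧ 0 < p 1 ∧ p 1 < 1}

theorem cross_smul_rightNormal {d : Plane} (hd : d ≠ 0) (t : ℝ) :
    cross d (t • rightNormal d) = -(t * ‖d‖) := by
  rw [← mul_neg, ← cross_rightNormal hd]
  simp only [cross, PiLp.smul_apply, smul_eq_mul]; ring

theorem volume_sideRectangle {a b : Plane} (hab : b - a ≠ 0) {t : ℝ} (ht : 0 < t) :
    volume (sideRectangle a b t) = ENNReal.ofReal (t * ‖b - a‖) := by
  rw [sideRectangle, volume_frame_image, volume_unit_square, mul_one, cross_smul_rightNormal hab,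
    abs_neg, abs_of_nonneg (by positivity)]

theorem measurableSet_sideRectangle {a b : Plane} (hab : b - a ≠ 0) {t : ℝ} (ht : 0 < t) :
    MeasurableSet (sideRectangle a b t) := by
  refine measurableSet_frame_image _ ?_ measurableSet_unit_square
  rw [cross_smul_rightNormal hab]
  have := norm_pos_iff.2 hab
  exact neg_ne_zero.2 (by positivity)

theorem exists_of_mem_sideRectangle {a b c x : Plane} {t : ℝ} (ht : 0 < t)
    (h : 0 < cross (b - a) (c - a)) (hx : x ∈ sideRectangle a b t) :
    ∃ σ : ℝ, 0 < σ ∧ σ < 1 ∧ ‖x - (a + σ • (b - a))‖ ≤ t ∧ ∀ z ∈ ({a, b, c} : Set Plane),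
      inner ℝ (x - (a + σ • (b - a))) z ≤ inner ℝ (x - (a + σ • (b - a))) (a + σ • (b - a)) := by
  have hd : b - a ≠ 0 := by intro h0; rw [h0] at h; simp [cross] at h
  obtain ⟨p, ⟨⟨h1, h2⟩, h3, h4⟩, rfl⟩ := hx
  have e : a + (p 0 • (b - a) + p 1 • t • rightNormal (b - a)) - (a + p 0 • (b - a))
      = (p 1 * t) • rightNormal (b - a) := by module
  refine ⟨p 0, h1, h2, ?_, ?_⟩
  · simp only [e]
    rw [norm_smul, norm_rightNormal hd, Real.norm_of_nonneg (by positivity)]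
    nlinarith
  · simp only [e]
    have i1 := inner_rightNormal_self (b - a)
    have i2 := inner_rightNormal (b - a) (c - a)
    have hn := norm_pos_iff.2 hd
    have i3 : 0 < ‖b - a‖⁻¹ * cross (b - a) (c - a) := by positivity
    have hpt : 0 ≤ p 1 * t := by positivity
    intro z hz
    simp only [inner_smul_left, conj_trivial]
    refine mul_le_mul_of_nonneg_left ?_ hpt
    rw [inner_add_right, inner_smul_right, i1, mul_zero, add_zero]
    rw [inner_sub_right _ b a] at i1
    rw [inner_sub_right _ c a] at i2
    rcases hz with rfl | rfl | rfl
    · exact le_rfl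
    · linarith
    · linarith

/-- Lower half of the Steiner formula. A triangle, three rectangles and three sectors are disjoint
because their points project to different open faces of the triangle. -/
theorem volume_roundedTriangle_ge {a b c : Plane} {t : ℝ} (ht : 0 < t)
    (h : 0 < cross (b - a) (c - a)) :
    ENNReal.ofReal (cross (b - a) (c - a) / 2 + t * (‖b - a‖ + ‖c - b‖ + ‖a - c‖) + Real.pi * t ^ 2)
      ≤ volume (roundedTriangle a b c t) := by
  have h2 : 0 < cross (c - b) (a - b) := by rwa [cross_rotate]
  have h3 : 0 < cross (a - c) (b - c) := by rwa [cross_rotate b c a, cross_rotate]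
  have d1 : b - a ≠ 0 := by intro h0; rw [h0] at h; simp [cross] at h
  have d2 : c - b ≠ 0 := by intro h0; rw [h0] at h2; simp [cross] at h2
  have d3 : a - c ≠ 0 := by intro h0; rw [h0] at h3; simp [cross] at h3
  set P : Fin 7 → Set Plane := ![
    (fun p : Plane => a + (p 0 • (b - a) + p 1 • (c - a))) ''
      {p : Plane | 0 < p 0 ∧ 0 < p 1 ∧ p 0 + p 1 < 1},
    sideRectangle a b t, sideRectangle b c t, sideRectangle c a t,
    (fun y => a + y) '' closedSector a b c t, (fun y => b + y) '' closedSector b c a t,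
    (fun y => c + y) '' closedSector c a b t] with hP
  -- For each piece, `B`, `C`, `A` record whether the barycentric weights at `b`, `c`, `a` of the
  -- foot point are positive; distinct pieces have distinct signatures.
  set B : Fin 7 → Bool := ![true, true, true, false, false, true, false] with hB
  set C : Fin 7 → Bool := ![true, false, true, true, false, false, true] with hC
  set A : Fin 7 → Bool := ![true, true, false, true, true, false, false] with hA
  have hproj : ∀ i, ∀ x ∈ P i, ∃ β γ, ProjectsTo a b c t x β γ ∧ (0 < β ↔ B i = true) ∧
      (0 < γ ↔ C i = true) ∧ (β + γ < 1 ↔ A i = true) := by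
    intro i x hx
    have mk : ∀ {p : Plane} {β γ : ℝ}, a + β • (b - a) + γ • (c - a) = p → 0 ≤ β → 0 ≤ γ →
        β + γ ≤ 1 → (∀ z ∈ ({a, b, c} : Set Plane), inner ℝ (x - p) z ≤ inner ℝ (x - p) p) →
        ‖x - p‖ ≤ t → ProjectsTo a b c t x β γ := by
      rintro p β γ rfl h1 h2 h3 h4 h5
      exact ⟨h1, h2, h3, h4, h5⟩
    fin_cases i
    · obtain ⟨p, ⟨h1, h2, h3⟩, rfl⟩ := hx
      refine ⟨p 0, p 1, mk (p := a + (p 0 • (b - a) + p 1 • (c - a))) (by abel) h1.le h2.le h3.le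
        ?_ ?_, ?_⟩
      · intro z _; simp
      · simpa using ht.le
      · simp [hA, hB, hC, h1, h2, h3]
    · obtain ⟨σ, s0, s1, hn, hi⟩ := exists_of_mem_sideRectangle ht h hx
      exact ⟨σ, 0, mk (by module) s0.le le_rfl (by linarith) hi hn, by simp [hA, hB, hC, s0, s1]⟩
    · obtain ⟨σ, s0, s1, hn, hi⟩ := exists_of_mem_sideRectangle ht h2 hx
      refine ⟨1 - σ, σ, mk (p := b + σ • (c - b)) (by module) (by linarith) s0.le (by linarith)
        (fun z hz => hi z ?_) hn, by simp [hA, hB, hC, s0, s1]⟩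
      simp only [Set.mem_insert_iff, Set.mem_singleton_iff] at hz ⊢; tauto
    · obtain ⟨σ, s0, s1, hn, hi⟩ := exists_of_mem_sideRectangle ht h3 hx
      refine ⟨0, 1 - σ, mk (p := c + σ • (a - c)) (by module) le_rfl (by linarith) (by linarith)
        (fun z hz => hi z ?_) hn, by simp [hA, hB, hC, s0, s1]⟩
      simp only [Set.mem_insert_iff, Set.mem_singleton_iff] at hz ⊢; tauto
    · obtain ⟨y, ⟨hy, hy1, hy2⟩, rfl⟩ := hx
      rw [inner_sub_right] at hy1 hy2
      refine ⟨0, 0, mk (p := a) (by module) le_rfl le_rfl (by norm_num) ?_ (by simpa using hy),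
        by simp [hA, hB, hC]⟩
      simp only [add_sub_cancel_left]
      rintro z (rfl | rfl | rfl) <;> linarith
    · obtain ⟨y, ⟨hy, hy1, hy2⟩, rfl⟩ := hx
      rw [inner_sub_right] at hy1 hy2
      refine ⟨1, 0, mk (p := b) (by module) (by norm_num) le_rfl (by norm_num) ?_
        (by simpa using hy), by simp [hA, hB, hC]⟩
      simp only [add_sub_cancel_left]
      rintro z (rfl | rfl | rfl) <;> linarith
    · obtain ⟨y, ⟨hy, hy1, hy2⟩, rfl⟩ := hx
      rw [inner_sub_right] at hy1 hy2
      refine ⟨0, 1, mk (p := c) (by module) le_rfl (by norm_num) (by norm_num) ?_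
        (by simpa using hy), by simp [hA, hB, hC]⟩
      simp only [add_sub_cancel_left]
      rintro z (rfl | rfl | rfl) <;> linarith
  have hinj : ∀ i j, B i = B j → C i = C j → A i = A j → i = j := by
    rw [hA, hB, hC]; decide
  have hdisj : Set.PairwiseDisjoint ((Finset.univ : Finset (Fin 7)) : Set (Fin 7)) P := by
    intro i _ j _ hij
    refine Set.disjoint_left.2 fun x hx hx' => hij ?_
    obtain ⟨β, γ, hp, hb, hc, ha⟩ := hproj i x hx
    obtain ⟨β', γ', hp', hb', hc', ha'⟩ := hproj j x hx'
    obtain ⟨rfl, rfl⟩ := hp.unique h.ne' hp'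
    exact hinj i j (Bool.eq_iff_iff.2 (hb.symm.trans hb')) (Bool.eq_iff_iff.2 (hc.symm.trans hc'))
      (Bool.eq_iff_iff.2 (ha.symm.trans ha'))
  have hsec : ∀ p q r : Plane, MeasurableSet ((fun y => p + y) '' closedSector p q r t) :=
    fun p q r => ((Homeomorph.addLeft p).isClosedMap _ (isClosed_closedSector p q r t)).measurableSet
  have hmeas : ∀ i ∈ (Finset.univ : Finset (Fin 7)), MeasurableSet (P i) := by
    intro i _
    fin_cases i
    · exact measurableSet_frame_image a h.ne' measurableSet_unit_triangle
    · exact measurableSet_sideRectangle d1 ht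
    · exact measurableSet_sideRectangle d2 ht
    · exact measurableSet_sideRectangle d3 ht
    · exact hsec a b c
    · exact hsec b c a
    · exact hsec c a b
  have hU : (⋃ i ∈ (Finset.univ : Finset (Fin 7)), P i) ⊆ roundedTriangle a b c t := by
    refine Set.iUnion₂_subset fun i _ x hx => ?_
    obtain ⟨β, γ, hp, -⟩ := hproj i x hx
    exact hp.mem_roundedTriangle
  have htr : ∀ (p : Plane) (S : Set Plane), volume ((fun y => p + y) '' S) = volume S := by
    intro p S
    rw [Set.image_add_left, measure_preimage_add]
  refine le_trans ?_ (measure_mono hU)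
  rw [measure_biUnion_finset hdisj hmeas, Fin.sum_univ_seven]
  have v0 : volume (P 0) = ENNReal.ofReal (cross (b - a) (c - a) / 2) := by
    change volume ((fun p : Plane => a + (p 0 • (b - a) + p 1 • (c - a))) '' _) = _
    rw [volume_frame_image, volume_unit_triangle, ← ENNReal.ofReal_mul (abs_nonneg _),
      abs_of_pos h]
    congr 1; ring
  have v1 : volume (P 1) = ENNReal.ofReal (t * ‖b - a‖) := volume_sideRectangle d1 ht
  have v2 : volume (P 2) = ENNReal.ofReal (t * ‖c - b‖) := volume_sideRectangle d2 ht
  have v3 : volume (P 3) = ENNReal.ofReal (t * ‖a - c‖) := volume_sideRectangle d3 ht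
  have v4 : volume (P 4) = volume (closedSector a b c t) := htr a _
  have v5 : volume (P 5) = volume (closedSector b c a t) := htr b _
  have v6 : volume (P 6) = volume (closedSector c a b t) := htr c _
  have hball := volume_closedBall_le_sum_closedSector a b c t
  rw [EuclideanSpace.volume_closedBall_fin_two] at hball
  have hπ : ENNReal.ofReal (Real.pi * t ^ 2) = ENNReal.ofReal t ^ 2 * ENNReal.ofReal Real.pi := by
    rw [mul_comm, ENNReal.ofReal_mul (by positivity), ENNReal.ofReal_pow ht.le]
  rw [v0, v1, v2, v3, v4, v5, v6]
  calc _ = ENNReal.ofReal (cross (b - a) (c - a) / 2) + ENNReal.ofReal (t * ‖b - a‖)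
        + ENNReal.ofReal (t * ‖c - b‖) + ENNReal.ofReal (t * ‖a - c‖)
        + ENNReal.ofReal (Real.pi * t ^ 2) := by
        rw [← ENNReal.ofReal_add (by positivity) (by positivity),
          ← ENNReal.ofReal_add (by positivity) (by positivity),
          ← ENNReal.ofReal_add (by positivity) (by positivity),
          ← ENNReal.ofReal_add (by positivity) (by positivity)]
        congr 1; ring
    _ ≤ ENNReal.ofReal (cross (b - a) (c - a) / 2) + ENNReal.ofReal (t * ‖b - a‖)
        + ENNReal.ofReal (t * ‖c - b‖) + ENNReal.ofReal (t * ‖a - c‖)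
        + (volume (closedSector a b c t) + volume (closedSector b c a t)
          + volume (closedSector c a b t)) := by
        rw [hπ]; gcongr
    _ = _ := by ring

/-! ### Support functions and a largest inscribed disc -/

/-- The support function of a set, in terms of the normal angle. -/
noncomputable def supportFun (K : Set Plane) (θ : ℝ) : ℝ :=
  sSup ((fun x : Plane => inner ℝ (direction θ) x) '' K)

theorem inner_le_supportFun {K : Set Plane} (hK : IsCompact K) (θ : ℝ) {x : Plane} (hx : x ∈ K) :
    inner ℝ (direction θ) x ≤ supportFun K θ :=
  le_csSup (isCompact_image_inner_direction hK θ).bddAbove ⟨x, hx, rfl⟩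

theorem exists_inner_eq_supportFun {K : Set Plane} (hK : IsCompact K) (hne : K.Nonempty) (θ : ℝ) :
    ∃ x ∈ K, inner ℝ (direction θ) x = supportFun K θ :=
  (isCompact_image_inner_direction hK θ).sSup_mem (hne.image _)

theorem continuous_supportFun {K : Set Plane} (hK : IsCompact K) : Continuous (supportFun K) :=
  hK.continuous_sSup (f := fun θ x => inner ℝ (direction θ) x) continuous_inner_direction

theorem supportFun_add_two_pi (K : Set Plane) (θ : ℝ) :
    supportFun K (θ + 2 * Real.pi) = supportFun K θ := by
  simp only [supportFun, direction_add_two_pi]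

/-- A point outside `K` is strictly separated from it, and the normalised separating functional is
one of the directions. -/
theorem mem_of_inner_le_supportFun {K : Set Plane} (hK : IsCompact K) (hc : Convex ℝ K)
    (hne : K.Nonempty) {x : Plane} (hx : ∀ θ, inner ℝ (direction θ) x ≤ supportFun K θ) :
    x ∈ K := by
  by_contra hn
  obtain ⟨f, s, hf, hfx⟩ := geometric_hahn_banach_closed_point hc hK.isClosed hn
  set w := (InnerProductSpace.toDual ℝ Plane).symm f with hw
  have hfw : ∀ y, f y = inner ℝ w y := fun y => by
    rw [hw, InnerProductSpace.toDual_symm_apply]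
  have hw0 : w ≠ 0 := by
    rintro h0
    obtain ⟨k, hk⟩ := hne
    have := hf k hk
    rw [hfw, h0, inner_zero_left] at this hfx
    linarith
  have hn0 : 0 < ‖w‖ := norm_pos_iff.2 hw0
  obtain ⟨θ, hθ⟩ := exists_direction_eq (u := ‖w‖⁻¹ • w) (by
    rw [norm_smul, norm_inv, norm_norm, inv_mul_cancel₀ hn0.ne'])
  obtain ⟨k, hk, e⟩ := exists_inner_eq_supportFun hK hne θ
  have h1 := hx θ
  rw [← e, hθ, inner_smul_left, inner_smul_left, ← hfw, ← hfw] at h1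
  have h2 := le_of_mul_le_mul_left h1 (by simpa using hn0)
  linarith [hf k hk]

theorem closedBall_subset_of_le_supportFun {K : Set Plane} (hK : IsCompact K) (hc : Convex ℝ K)
    (hne : K.Nonempty) {O : Plane} {r : ℝ}
    (h : ∀ θ, inner ℝ (direction θ) O + r ≤ supportFun K θ) : Metric.closedBall O r ⊆ K := by
  intro x hx
  refine mem_of_inner_le_supportFun hK hc hne fun θ => le_trans ?_ (h θ)
  have h1 := real_inner_le_norm (direction θ) (x - O)
  rw [norm_direction, one_mul, inner_sub_right] at h1
  rw [mem_closedBall_iff_norm] at hx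
  linarith

/-- By Carathéodory three points suffice in the plane, so the hull is a continuous image of a
simplex times C³. -/
theorem isCompact_convexHull_plane {C : Set Plane} (hC : IsCompact C) :
    IsCompact (convexHull ℝ C) := by
  have himg : convexHull ℝ C = (fun p : (Fin 3 → ℝ) × (Fin 3 → Plane) => ∑ i, p.1 i • p.2 i) ''
      (stdSimplex ℝ (Fin 3) ×ˢ Set.univ.pi fun _ => C) := by
    apply Set.Subset.antisymm
    · intro x hx
      obtain ⟨ι, _, z, w, hz, hind, hw, hw1, rfl⟩ := eq_pos_convex_span_of_mem_convexHull hx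
      have hne : Nonempty ι := by
        by_contra h
        rw [not_nonempty_iff] at h
        simp at hw1
      obtain ⟨i₀⟩ := hne
      have hcard : Fintype.card ι ≤ Fintype.card (Fin 3) := by
        have h := hind.card_le_finrank_succ
        have h2 := Submodule.finrank_le (vectorSpan ℝ (Set.range z))
        rw [finrank_euclideanSpace_fin] at h2
        rw [Fintype.card_fin]
        omega
      obtain ⟨e⟩ := Function.Embedding.nonempty_of_card_le hcard
      -- Combinations with fewer than three points are padded with weight 0 and the arbitrary point
      -- `z i₀`.
      have hwe : ∀ i, Function.extend e w 0 (e i) = w i := e.injective.extend_apply w _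
      have hze : ∀ i, Function.extend e z (fun _ => z i₀) (e i) = z i :=
        e.injective.extend_apply z _
      have hw0 : ∀ j, j ∉ Set.range e → Function.extend e w 0 j = 0 := fun j hj =>
        Function.extend_apply' w _ j fun ⟨i, hi⟩ => hj ⟨i, hi⟩
      refine ⟨(Function.extend e w 0, Function.extend e z fun _ => z i₀), ⟨⟨fun j => ?_, ?_⟩,
        fun j _ => ?_⟩, ?_⟩
      · by_cases hj : j ∈ Set.range e
        · obtain ⟨i, rfl⟩ := hj
          simp only [hwe]; exact (hw i).le
        · simp only [hw0 j hj]; exact le_rfl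
      · rw [← hw1]
        refine (Finset.sum_of_injOn e e.injective.injOn (by simp) (fun j _ hj => ?_)
          (fun i _ => (hwe i).symm)).symm
        exact hw0 j (by simpa using hj)
      · by_cases hj : j ∈ Set.range e
        · obtain ⟨i, rfl⟩ := hj
          simp only [hze]; exact hz ⟨i, rfl⟩
        · simp only
          rw [Function.extend_apply' _ _ _ fun ⟨i, hi⟩ => hj ⟨i, hi⟩]
          exact hz ⟨i₀, rfl⟩
      · refine (Finset.sum_of_injOn e e.injective.injOn (by simp) (fun j _ hj => ?_)
          (fun i _ => by simp only [hwe, hze])).symm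
        simp only [hw0 j (by simpa using hj), zero_smul]
    · rintro _ ⟨⟨w, z⟩, ⟨⟨hw, hw1⟩, hz⟩, rfl⟩
      exact (convex_convexHull ℝ C).sum_mem (fun i _ => hw i) hw1
        fun i _ => subset_convexHull ℝ C (hz i trivial)
  rw [himg]
  refine ((isCompact_stdSimplex ℝ (Fin 3)).prod (isCompact_univ_pi fun _ => hC)).image ?_
  fun_prop

/-- A nonnegative function on a compact set becomes positive after adding a small multiple of a
function that is positive at its zeros. -/
theorem IsCompact.exists_pos_forall_add_mul_pos {α : Type*} [TopologicalSpace α] {I : Set α}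
    (hI : IsCompact I) {F G : α → ℝ} (hF : Continuous F) (hG : Continuous G)
    (h0 : ∀ x ∈ I, 0 ≤ F x) (h : ∀ x ∈ I, G x ≤ 0 → 0 < F x) :
    ∃ ε > 0, ∀ x ∈ I, 0 < F x + ε * G x := by
  set J := I ∩ {x | G x ≤ 0} with hJ
  have hJc : IsCompact J := hI.inter_right (isClosed_le hG continuous_const)
  have hout : ∀ ε > 0, ∀ x ∈ I, x ∉ J → 0 < F x + ε * G x := by
    intro ε hε x hx hxJ
    have h1 : 0 < G x := by
      by_contra h; exact hxJ ⟨hx, not_lt.1 h⟩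
    have := h0 x hx
    have := mul_pos hε h1
    linarith
  rcases J.eq_empty_or_nonempty with hJe | hJne
  · exact ⟨1, one_pos, fun x hx => hout 1 one_pos x hx (by simp [hJe])⟩
  · obtain ⟨x₁, hx₁, hmin⟩ := hJc.exists_isMinOn hJne hF.continuousOn
    obtain ⟨x₂, hx₂, hmin'⟩ := hJc.exists_isMinOn hJne hG.continuousOn
    have hη := h x₁ hx₁.1 hx₁.2
    have hM : 0 < 2 * (1 - G x₂) := by have : G x₂ ≤ 0 := hx₂.2; linarith
    -- With this `ε` the perturbation on `J` is at least minus half the minimum of `F` there.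
    refine ⟨F x₁ / (2 * (1 - G x₂)), by positivity, fun x hx => ?_⟩
    by_cases hxJ : x ∈ J
    · have h1 : F x₁ ≤ F x := hmin hxJ
      have h2 : G x₂ ≤ G x := hmin' hxJ
      have h3 : F x₁ / (2 * (1 - G x₂)) * (-(1 - G x₂)) ≤ F x₁ / (2 * (1 - G x₂)) * G x := by
        apply mul_le_mul_of_nonneg_left _ (by positivity); linarith
      have h4 : F x₁ / (2 * (1 - G x₂)) * (-(1 - G x₂)) = -(F x₁ / 2) := by
        have : 1 - G x₂ ≠ 0 := by linarith
        field_simp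
      linarith
    · exact hout _ (by positivity) x hx hxJ

/-- The distance from `x` to the supporting line of `K` with normal angle `θ`. -/
noncomputable def supportGap (K : Set Plane) (x : Plane) (θ : ℝ) : ℝ :=
  supportFun K θ - inner ℝ (direction θ) x

theorem continuous_supportGap {K : Set Plane} (hK : IsCompact K) :
    Continuous fun p : Plane × ℝ => supportGap K p.1 p.2 := by
  unfold supportGap
  exact ((continuous_supportFun hK).comp continuous_snd).sub
    ((continuous_direction.comp continuous_snd).inner continuous_fst)

/-- A convex body contains a disc whose contact normals have the origin in their convex hull. -/
theorem exists_inscribed_disc {K : Set Plane} (hK : IsCompact K) (hc : Convex ℝ K)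
    (hne : K.Nonempty) : ∃ O : Plane, ∃ r : ℝ,
      (∀ θ, inner ℝ (direction θ) O + r ≤ supportFun K θ) ∧
      (0 : Plane) ∈ convexHull ℝ
        (direction '' {θ | inner ℝ (direction θ) O + r = supportFun K θ}) := by
  set I := Set.Icc 0 (2 * Real.pi) with hI
  have hIc : IsCompact I := isCompact_Icc
  have hIne : I.Nonempty := ⟨0, le_rfl, Real.two_pi_pos.le⟩
  have hgx : ∀ x, Continuous (supportGap K x) := by
    intro x
    unfold supportGap
    exact (continuous_supportFun hK).sub (continuous_direction.inner continuous_const)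
  -- For a point of `K` this is the largest radius of a disc centred there and contained in `K`; `O`
  -- is chosen to maximise it.
  set ρ : Plane → ℝ := fun x => sInf (supportGap K x '' I) with hρ
  have hρc : Continuous ρ := hIc.continuous_sInf (continuous_supportGap hK)
  obtain ⟨O, hO, hmax⟩ := hK.exists_isMaxOn hne hρc.continuousOn
  have hρle : ∀ x, ∀ θ ∈ I, ρ x ≤ supportGap K x θ := fun x θ hθ =>
    csInf_le (hIc.image (hgx x)).bddBelow ⟨θ, hθ, rfl⟩
  have hρmem : ∀ x, ∃ θ ∈ I, supportGap K x θ = ρ x := fun x =>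
    (hIc.image (hgx x)).sInf_mem (hIne.image _)
  have hred : ∀ θ, ∃ ψ ∈ I, direction ψ = direction θ ∧ supportFun K ψ = supportFun K θ := by
    intro θ
    have hper : Function.Periodic (fun θ => (direction θ, supportFun K θ)) (2 * Real.pi) :=
      fun θ => by simp only [direction_add_two_pi, supportFun_add_two_pi]
    obtain ⟨ψ, hψ, e⟩ := hper.exists_mem_Ico₀ Real.two_pi_pos θ
    exact ⟨ψ, ⟨hψ.1, hψ.2.le⟩, (Prod.ext_iff.1 e).1.symm, (Prod.ext_iff.1 e).2.symm⟩
  have hρ0 : 0 ≤ ρ O := by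
    obtain ⟨θ, -, e⟩ := hρmem O
    rw [← e]
    exact sub_nonneg.2 (inner_le_supportFun hK θ hO)
  refine ⟨O, ρ O, fun θ => ?_, ?_⟩
  · obtain ⟨ψ, hψ, e1, e2⟩ := hred θ
    have := hρle O ψ hψ
    simp only [supportGap, e1, e2] at this
    linarith
  · by_contra hn
    -- If 0 is outside the hull, some `w` has positive inner product with every contact normal.
    -- Moving `O` by a small multiple of `-w` then makes every gap exceed `ρ O`, against maximality.
    -- Restricting to one period keeps `C` compact.
    set C := direction '' (I ∩ {θ | inner ℝ (direction θ) O + ρ O = supportFun K θ}) with hC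
    have hCc : IsCompact C := by
      refine (hIc.inter_right (isClosed_eq ?_ (continuous_supportFun hK))).image
        continuous_direction
      exact (continuous_direction.inner continuous_const).add continuous_const
    have hn' : (0 : Plane) ∉ convexHull ℝ C := fun h =>
      hn (convexHull_mono (Set.image_mono Set.inter_subset_right) h)
    obtain ⟨f, s, hf0, hf⟩ := geometric_hahn_banach_point_closed (convex_convexHull ℝ C)
      (isCompact_convexHull_plane hCc).isClosed hn'
    rw [map_zero] at hf0
    set w := (InnerProductSpace.toDual ℝ Plane).symm f with hw
    have hfw : ∀ y, f y = inner ℝ y w := fun y => by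
      rw [hw, real_inner_comm, InnerProductSpace.toDual_symm_apply]
    have hGc : Continuous fun θ => inner ℝ (direction θ) w :=
      continuous_direction.inner continuous_const
    have hpos : ∀ θ ∈ I, inner ℝ (direction θ) w ≤ 0 → 0 < supportGap K O θ - ρ O := by
      intro θ hθ hle
      refine lt_of_le_of_ne (sub_nonneg.2 (hρle O θ hθ)) fun h0 => ?_
      have hmem : direction θ ∈ C := by
        refine ⟨θ, ⟨hθ, ?_⟩, rfl⟩
        simp only [supportGap] at h0
        change inner ℝ (direction θ) O + ρ O = supportFun K θ
        linarith
      have := hf _ (subset_convexHull ℝ _ hmem)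
      rw [hfw] at this
      linarith
    obtain ⟨ε, hε, hεpos⟩ := hIc.exists_pos_forall_add_mul_pos
      (F := fun θ => supportGap K O θ - ρ O) ((hgx O).sub continuous_const) hGc
      (fun θ hθ => sub_nonneg.2 (hρle O θ hθ)) hpos
    have hgap' : ∀ θ, supportGap K (O - ε • w) θ = supportGap K O θ + ε * inner ℝ (direction θ) w := by
      intro θ; simp only [supportGap, inner_sub_right, inner_smul_right]; ring
    have hO' : O - ε • w ∈ K := by
      refine mem_of_inner_le_supportFun hK hc hne fun θ => ?_
      obtain ⟨ψ, hψ, e1, e2⟩ := hred θ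
      have h1 := hεpos ψ hψ
      have h2 := hgap' ψ
      simp only [supportGap, e1, e2] at h1 h2
      linarith
    have h1 := hmax hO'
    obtain ⟨θ, hθ, e⟩ := hρmem (O - ε • w)
    have h2 := hεpos θ hθ
    rw [hgap'] at e
    have h3 : ρ (O - ε • w) ≤ ρ O := h1
    linarith

/-! ### Area of the triangle of opposite points -/

theorem abs_cross_le_norm_mul_norm (v w : Plane) : |cross v w| ≤ ‖v‖ * ‖w‖ := by
  refine abs_le_of_sq_le_sq ?_ (by positivity)
  rw [mul_pow, norm_sq_plane, norm_sq_plane, cross]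
  nlinarith [sq_nonneg (v 0 * w 0 + v 1 * w 1)]

/-- A triangle inscribed in the unit circle has area at most that of the equilateral one. -/
theorem cross_sub_le_of_norm_eq_one {u₁ u₂ u₃ : Plane} (h₁ : ‖u₁‖ = 1) (h₂ : ‖u₂‖ = 1)
    (h₃ : ‖u₃‖ = 1) : cross (u₂ - u₁) (u₃ - u₁) ≤ 3 * Real.sqrt 3 / 2 := by
  set y := ‖u₂ - u₃‖ with hy
  have hy0 : 0 ≤ y := norm_nonneg _
  have hy2 : y ≤ 2 := by
    calc y ≤ ‖u₂‖ + ‖u₃‖ := norm_sub_le _ _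
      _ = 2 := by rw [h₂, h₃]; norm_num
  -- For a fixed chord `y` the vertex `u₁` contributes at most `y`, which leaves an inequality in
  -- one variable.
  have e : cross (u₂ - u₁) (u₃ - u₁) = cross u₂ u₃ + cross u₁ (u₂ - u₃) := by
    simp only [cross, PiLp.sub_apply]; ring
  have b := (le_abs_self _).trans (abs_cross_le_norm_mul_norm u₁ (u₂ - u₃))
  rw [h₁, one_mul, ← hy] at b
  have hS : cross u₂ u₃ ^ 2 = y ^ 2 - y ^ 4 / 4 := by
    have n2 := norm_sq_plane u₂
    have n3 := norm_sq_plane u₃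
    have n4 := norm_sq_plane (u₂ - u₃)
    rw [h₂, one_pow] at n2
    rw [h₃, one_pow] at n3
    rw [← hy] at n4
    simp only [PiLp.sub_apply] at n4
    have hC : 2 * (u₂ 0 * u₃ 0 + u₂ 1 * u₃ 1) = 2 - y ^ 2 := by linarith
    have : cross u₂ u₃ ^ 2 + (u₂ 0 * u₃ 0 + u₂ 1 * u₃ 1) ^ 2
        = (u₂ 0 ^ 2 + u₂ 1 ^ 2) * (u₃ 0 ^ 2 + u₃ 1 ^ 2) := by
      rw [cross]; ring
    rw [← n2, ← n3] at this
    have hC' : u₂ 0 * u₃ 0 + u₂ 1 * u₃ 1 = 1 - y ^ 2 / 2 := by linarith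
    rw [hC'] at this
    linarith
  set k := Real.sqrt 3 with hk
  have hk2 : k ^ 2 = 3 := Real.sq_sqrt (by norm_num)
  have hk1 : 17 / 10 ≤ k := Real.le_sqrt_of_sq_le (by norm_num)
  have hmain : cross u₂ u₃ ≤ 3 * k / 2 - y := by
    refine le_of_sq_le_sq ?_ (by linarith)
    rw [hS]
    -- The double root `y = √3` is the side of the inscribed equilateral triangle.
    have h5 : 0 ≤ (y - k) ^ 2 * (y ^ 2 + 2 * k * y + 9) := by positivity
    have h6 : (y - k) ^ 2 * (y ^ 2 + 2 * k * y + 9) = y ^ 4 - 12 * k * y + 27 := by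
      linear_combination (-3 * y ^ 2 + 2 * k * y + 9) * hk2
    nlinarith
  linarith

theorem mul_mul_le_of_sum_eq_one {a b c : ℝ} (ha : 0 < a) (hb : 0 < b) (hc : 0 < c)
    (h : a + b + c = 1) : a * b * c ≤ 1 / 27 := by
  obtain rfl : c = 1 - a - b := by linarith
  nlinarith [mul_nonneg ha.le (sq_nonneg (b - (1 - a - b))),
    mul_nonneg hb.le (sq_nonneg (a - (1 - a - b))), mul_nonneg hc.le (sq_nonneg (a - b)),
    sq_nonneg (a - b), sq_nonneg (a - 1 / 3), sq_nonneg (b - 1 / 3)]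

/-- A row-stochastic `3 × 3` matrix has determinant at least its trace minus two. -/
theorem trace_sub_two_le_det {a b c d e f : ℝ} (ha : 0 ≤ a) (hb : 0 ≤ b) (hc : 0 ≤ c) (hd : 0 ≤ d)
    (he : 0 ≤ e) (hf : 0 ≤ f) :
    (1 - a - b) + (1 - c - d) + (1 - e - f) - 2 ≤
      (1 - a - b) * ((1 - c - d) * (1 - e - f) - d * f) - a * (c * (1 - e - f) - d * e)
        + b * (c * f - (1 - c - d) * e) := by
  have : (1 - a - b) * ((1 - c - d) * (1 - e - f) - d * f) - a * (c * (1 - e - f) - d * e)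
        + b * (c * f - (1 - c - d) * e)
      = 1 - (a + b + c + d + e + f) + (a * d + b * c + b * d + a * e + a * f + b * f
        + c * e + c * f + d * e) := by ring
  rw [this]
  have : 0 ≤ a * d + b * c + b * d + a * e + a * f + b * f + c * e + c * f + d * e := by positivity
  linarith

/-- A lower bound for the area of a triangle whose vertices `y₁`, `y₂`, `y₃` lie far out in the
three corners of the triangle circumscribed to a disc with contact normals `u₁`, `u₂`, `u₃`. -/
theorem le_abs_cross_of_contact {u₁ u₂ u₃ y₁ y₂ y₃ : Plane} {s₁ s₂ s₃ r : ℝ}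
    (n₁ : ‖u₁‖ = 1) (n₂ : ‖u₂‖ = 1) (n₃ : ‖u₃‖ = 1) (p₁ : 0 < s₁) (p₂ : 0 < s₂) (p₃ : 0 < s₃)
    (hs : s₁ + s₂ + s₃ = 1) (hu : s₁ • u₁ + s₂ • u₂ + s₃ • u₃ = 0) (hr : 0 < r)
    (h₁₁ : inner ℝ u₁ y₁ ≤ r - 1) (h₁₂ : inner ℝ u₂ y₁ ≤ r) (h₁₃ : inner ℝ u₃ y₁ ≤ r)
    (h₂₁ : inner ℝ u₁ y₂ ≤ r) (h₂₂ : inner ℝ u₂ y₂ ≤ r - 1) (h₂₃ : inner ℝ u₃ y₂ ≤ r)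
    (h₃₁ : inner ℝ u₁ y₃ ≤ r) (h₃₂ : inner ℝ u₂ y₃ ≤ r) (h₃₃ : inner ℝ u₃ y₃ ≤ r - 1) :
    6 * Real.sqrt 3 * (r * (1 - 2 * r)) ≤ |cross (y₂ - y₁) (y₃ - y₁)| := by
  set D := cross (u₂ - u₁) (u₃ - u₁) with hD
  set X := cross (y₂ - y₁) (y₃ - y₁) with hX
  have hrow : ∀ y, s₁ * inner ℝ u₁ y + s₂ * inner ℝ u₂ y + s₃ * inner ℝ u₃ y = 0 := by
    intro y
    have := congrArg (fun v => inner ℝ v y) hu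
    simpa [inner_add_left, inner_smul_left] using this
  have key : r * (1 - 2 * r) ≤ s₁ * s₂ * s₃ * (X * D) := by
    have hw : ∀ s v : ℝ, 0 < s → v ≤ r → 0 ≤ s * (r - v) / r := fun s v h1 h2 =>
      div_nonneg (mul_nonneg h1.le (by linarith)) hr.le
    have hdet := trace_sub_two_le_det (hw s₂ _ p₂ h₁₂) (hw s₃ _ p₃ h₁₃) (hw s₁ _ p₁ h₂₁)
      (hw s₃ _ p₃ h₂₃) (hw s₁ _ p₁ h₃₁) (hw s₂ _ p₂ h₃₂)
    have w₁ : 1 - s₂ * (r - inner ℝ u₂ y₁) / r - s₃ * (r - inner ℝ u₃ y₁) / r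
        = s₁ * (r - inner ℝ u₁ y₁) / r := by
      field_simp; linear_combination r * -hs + hrow y₁
    have w₂ : 1 - s₁ * (r - inner ℝ u₁ y₂) / r - s₃ * (r - inner ℝ u₃ y₂) / r
        = s₂ * (r - inner ℝ u₂ y₂) / r := by
      field_simp; linear_combination r * -hs + hrow y₂
    have w₃ : 1 - s₁ * (r - inner ℝ u₁ y₃) / r - s₂ * (r - inner ℝ u₂ y₃) / r
        = s₃ * (r - inner ℝ u₃ y₃) / r := by
      field_simp; linear_combination r * -hs + hrow y₃
    rw [w₁, w₂, w₃] at hdet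
    have t₁ : s₁ / r ≤ s₁ * (r - inner ℝ u₁ y₁) / r := by gcongr; nlinarith
    have t₂ : s₂ / r ≤ s₂ * (r - inner ℝ u₂ y₂) / r := by gcongr; nlinarith
    have t₃ : s₃ / r ≤ s₃ * (r - inner ℝ u₃ y₃) / r := by gcongr; nlinarith
    have hsum : s₁ / r + s₂ / r + s₃ / r = 1 / r := by rw [← add_div, ← add_div, hs]
    have hval : s₁ * (r - inner ℝ u₁ y₁) / r * (s₂ * (r - inner ℝ u₂ y₂) / r
          * (s₃ * (r - inner ℝ u₃ y₃) / r) - s₃ * (r - inner ℝ u₃ y₂) / r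
          * (s₂ * (r - inner ℝ u₂ y₃) / r)) - s₂ * (r - inner ℝ u₂ y₁) / r
          * (s₁ * (r - inner ℝ u₁ y₂) / r * (s₃ * (r - inner ℝ u₃ y₃) / r)
          - s₃ * (r - inner ℝ u₃ y₂) / r * (s₁ * (r - inner ℝ u₁ y₃) / r))
          + s₃ * (r - inner ℝ u₃ y₁) / r * (s₁ * (r - inner ℝ u₁ y₂) / r
          * (s₂ * (r - inner ℝ u₂ y₃) / r) - s₂ * (r - inner ℝ u₂ y₂) / r
          * (s₁ * (r - inner ℝ u₁ y₃) / r))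
        = s₁ * s₂ * s₃ * (X * D) / r ^ 2 := by
      -- The matrix factors into one with rows `(1, y i)` and one with columns `(r, -u j)`, so its
      -- determinant is the product of `X` and `r * D`.
      have hdetF : (r - inner ℝ u₁ y₁) * ((r - inner ℝ u₂ y₂) * (r - inner ℝ u₃ y₃)
          - (r - inner ℝ u₃ y₂) * (r - inner ℝ u₂ y₃))
          - (r - inner ℝ u₂ y₁) * ((r - inner ℝ u₁ y₂) * (r - inner ℝ u₃ y₃)
          - (r - inner ℝ u₃ y₂) * (r - inner ℝ u₁ y₃))
          + (r - inner ℝ u₃ y₁) * ((r - inner ℝ u₁ y₂) * (r - inner ℝ u₂ y₃)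
          - (r - inner ℝ u₂ y₂) * (r - inner ℝ u₁ y₃)) = r * (X * D) := by
        simp only [inner_plane, hX, hD, cross, PiLp.sub_apply]
        ring
      field_simp
      linear_combination hdetF
    rw [hval] at hdet
    have h7 : 1 / r - 2 ≤ s₁ * s₂ * s₃ * (X * D) / r ^ 2 := by linarith
    rw [le_div_iff₀ (by positivity)] at h7
    have h8 : (1 / r - 2) * r ^ 2 = r * (1 - 2 * r) := by field_simp
    linarith
  have hDabs : |D| ≤ 3 * Real.sqrt 3 / 2 := by
    refine abs_le'.2 ⟨cross_sub_le_of_norm_eq_one n₁ n₂ n₃, ?_⟩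
    have : -D = cross (u₃ - u₁) (u₂ - u₁) := by rw [hD, cross, cross]; ring
    rw [this]
    exact cross_sub_le_of_norm_eq_one n₁ n₃ n₂
  have hamgm := mul_mul_le_of_sum_eq_one p₁ p₂ p₃ hs
  have h9 : r * (1 - 2 * r) ≤ 1 / 27 * (|X| * (3 * Real.sqrt 3 / 2)) := by
    refine key.trans ?_
    have hXD : X * D ≤ |X| * (3 * Real.sqrt 3 / 2) := by
      calc X * D ≤ |X * D| := le_abs_self _
        _ = |X| * |D| := abs_mul _ _
        _ ≤ _ := by gcongr
    calc s₁ * s₂ * s₃ * (X * D) ≤ s₁ * s₂ * s₃ * (|X| * (3 * Real.sqrt 3 / 2)) := by gcongr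
      _ ≤ _ := by gcongr
  have h3 : Real.sqrt 3 ^ 2 = 3 := Real.sq_sqrt (by norm_num)
  calc 6 * Real.sqrt 3 * (r * (1 - 2 * r))
      ≤ 6 * Real.sqrt 3 * (1 / 27 * (|X| * (3 * Real.sqrt 3 / 2))) := by gcongr
    _ = |X| * (Real.sqrt 3 ^ 2 / 3) := by ring
    _ = |X| := by rw [h3]; norm_num

/-! ### The Cheeger constant from above -/

theorem cheegerConstant_le_of_subset {K E : Set Plane} {t P : ℝ} (hEK : E ⊆ K) (hc : Convex ℝ E)
    (ht : 0 < t) (hP0 : 0 < P) (hP : perimeter E ≤ ENNReal.ofReal P)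
    (hV : ENNReal.ofReal (t * P) ≤ volume E) : cheegerConstant K ≤ ENNReal.ofReal (1 / t) := by
  have hpos : 0 < volume E := (ENNReal.ofReal_pos.2 (mul_pos ht hP0)).trans_le hV
  have hmem : cheegerConstant K ≤ perimeter E / volume E := by
    unfold cheegerConstant
    exact sInf_le ⟨E, hEK, hc, hpos, rfl⟩
  refine hmem.trans (ENNReal.div_le_of_le_mul ?_)
  calc perimeter E ≤ ENNReal.ofReal P := hP
    _ = ENNReal.ofReal (1 / t) * ENNReal.ofReal (t * P) := by
      rw [← ENNReal.ofReal_mul (by positivity)]; congr 1; field_simp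
    _ ≤ _ := by gcongr

theorem cheegerConstant_le_of_closedBall_subset {K : Set Plane} {O : Plane} {r t : ℝ}
    (hB : Metric.closedBall O r ⊆ K) (ht : 0 < t) (hr : 2 * t ≤ r) :
    cheegerConstant K ≤ ENNReal.ofReal (1 / t) := by
  have hr0 : 0 < r := by linarith
  refine cheegerConstant_le_of_subset (P := 2 * Real.pi * r) hB (convex_closedBall O r) ht
    (by positivity) ?_ ?_
  · rw [perimeter, frontier_closedBall O hr0.ne']
    have : Metric.sphere O r ⊆ (fun y => O + y) '' Metric.sphere 0 r := by
      intro x hx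
      exact ⟨x - O, by simpa [dist_eq_norm] using hx, by simp⟩
    exact (measure_mono this).trans ((hausdorffMeasure_add_image_le _ _).trans
      (hausdorffMeasure_sphere_le hr0))
  · rw [EuclideanSpace.volume_closedBall_fin_two, ← ENNReal.ofReal_pow hr0.le,
      ← ENNReal.ofReal_mul (by positivity)]
    apply ENNReal.ofReal_le_ofReal
    nlinarith [mul_le_mul_of_nonneg_left hr (by positivity : 0 ≤ Real.pi * r)]

/-- The competitor is the triangle shrunk towards `O` by `1 - t / r`, plus a disc of radius `t`. In
area minus `t` times perimeter the side lengths cancel, leaving the shrunken area minus πt², which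
`hA` makes nonnegative. -/
theorem cheegerConstant_le_of_triangle {K : Set Plane} (hc : Convex ℝ K) {O a b c : Plane}
    {r t : ℝ} (hB : Metric.closedBall O r ⊆ K) (ha : a ∈ K) (hb : b ∈ K) (hcK : c ∈ K)
    (ht : 0 < t) (htr : t < r)
    (hA : Real.pi * t ^ 2 ≤ (1 - t / r) ^ 2 * (|cross (b - a) (c - a)| / 2)) :
    cheegerConstant K ≤ ENNReal.ofReal (1 / t) := by
  have hr0 : 0 < r := by linarith
  wlog hpos : 0 ≤ cross (b - a) (c - a) generalizing b c
  · have hsw : cross (c - a) (b - a) = -cross (b - a) (c - a) := by rw [cross, cross]; ring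
    refine this hcK hb ?_ ?_
    · rwa [hsw, abs_neg]
    · rw [hsw]; push Not at hpos; linarith
  rw [abs_of_nonneg hpos] at hA
  set l := 1 - t / r with hl
  have hl0 : 0 < l := by rw [hl, sub_pos, div_lt_one hr0]; exact htr
  set f : Plane → Plane := fun x => O + l • (x - O) with hf
  have hdiff : ∀ x y, f x - f y = l • (x - y) := by intro x y; simp only [hf]; module
  have hcross : cross (f b - f a) (f c - f a) = l ^ 2 * cross (b - a) (c - a) := by
    rw [hdiff, hdiff]; simp only [cross, PiLp.smul_apply, smul_eq_mul]; ring
  have hcr : 0 < cross (f b - f a) (f c - f a) := by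
    rw [hcross]
    have : 0 < Real.pi * t ^ 2 := by positivity
    linarith
  have hsub : roundedTriangle (f a) (f b) (f c) t ⊆ K := by
    rintro _ ⟨p, hp, y, hy, rfl⟩
    have hy' : ‖y‖ ≤ t := by simpa using hy
    have hconv : Convex ℝ {x : Plane | x + y ∈ K} := by
      intro u hu v hv α β hα hβ hαβ
      have := hc hu hv hα hβ hαβ
      have e : α • (u + y) + β • (v + y) = α • u + β • v + y := by
        calc α • (u + y) + β • (v + y) = α • u + β • v + (α + β) • y := by module
          _ = _ := by rw [hαβ, one_smul]
      rw [e] at this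
      exact this
    have hmem : ∀ x ∈ K, f x + y ∈ K := by
      intro x hx
      -- The shifted point `f x + y` is the convex combination, with weights `l` and `t / r`, of `x`
      -- and this point of the inscribed disc.
      have hz : O + (r / t) • y ∈ K := by
        apply hB
        rw [mem_closedBall_iff_norm, add_sub_cancel_left, norm_smul,
          Real.norm_of_nonneg (by positivity), div_mul_eq_mul_div, div_le_iff₀ ht]
        gcongr
      have h1 := hc hx hz hl0.le (div_nonneg ht.le hr0.le) (by rw [hl]; ring)
      have e : l • x + (t / r) • (O + (r / t) • y) = f x + y := by
        have e1 : (t / r) • (r / t) • y = y := by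
          rw [smul_smul, div_mul_div_cancel₀ hr0.ne', div_self ht.ne', one_smul]
        rw [smul_add, e1]
        simp only [hf, hl]; module
      rwa [e] at h1
    refine convexHull_min ?_ hconv hp
    rintro z (rfl | rfl | rfl)
    · exact hmem a ha
    · exact hmem b hb
    · exact hmem c hcK
  refine cheegerConstant_le_of_subset hsub (convex_roundedTriangle _ _ _ _) ht (by positivity)
    (perimeter_roundedTriangle_le ht hcr) (le_trans ?_ (volume_roundedTriangle_ge ht hcr))
  apply ENNReal.ofReal_le_ofReal
  rw [hcross]
  linarith

/-- The upper bound for the Cheeger constant of a convex body of width at least one. -/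
theorem cheegerConstant_le_of_widthAtLeast {K : Set Plane} (hK : IsCompact K) (hc : Convex ℝ K)
    (hne : K.Nonempty) (hw : WidthAtLeast K 1) {t : ℝ} (ht1 : 187 / 1000 ≤ t)
    (ht2 : t ≤ 188 / 1000) (ht : (1 - 3 * t) ^ 2 = Real.sqrt 3 * Real.pi * t ^ 2) :
    cheegerConstant K ≤ ENNReal.ofReal (1 / t) := by
  obtain ⟨O, r, hr, h0⟩ := exists_inscribed_disc hK hc hne
  have hB := closedBall_subset_of_le_supportFun hK hc hne hr
  have ht0 : 0 < t := by linarith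
  -- The threshold is twice the upper bound for `t`, enough for the disc alone to have ratio `2 / r
  -- ≤ 1 / t`.
  rcases le_or_gt (376 / 1000) r with hbig | hsmall
  · exact cheegerConstant_le_of_closedBall_subset hB ht0 (by linarith)
  obtain ⟨ι, _, z, s, hz, hind, hs, hs1, hsz⟩ := eq_pos_convex_span_of_mem_convexHull h0
  have hcontact : ∀ i, ‖z i‖ = 1 ∧ (∀ x ∈ K, inner ℝ (z i) (x - O) ≤ r) ∧
      ∃ q ∈ K, inner ℝ (z i) (q - O) ≤ r - 1 := by
    intro i
    obtain ⟨θ, hθ, e⟩ := hz ⟨i, rfl⟩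
    change inner ℝ (direction θ) O + r = supportFun K θ at hθ
    have hle : ∀ x ∈ K, inner ℝ (direction θ) (x - O) ≤ r := by
      intro x hx
      have := inner_le_supportFun hK θ hx
      rw [inner_sub_right]; linarith
    rw [← e]
    refine ⟨norm_direction θ, hle, ?_⟩
    obtain ⟨x, hx, y, hy, hxy⟩ := exists_inner_sub_ge_width hK hne θ
    have h1 := hw θ
    have h2 := hle x hx
    rw [hxy, inner_sub_right] at h1
    refine ⟨y, hy, ?_⟩
    rw [inner_sub_right] at h2 ⊢
    linarith
  choose hn hle q hqK hq using hcontact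
  -- Pairing the zero combination with `q i - O`, every term is at most `s j * r`, and the `i`-th
  -- falls short of it by at least `s i`.
  have hsr : ∀ i, s i ≤ r := by
    classical
    intro i
    have h1 := congrArg (fun v => inner ℝ v (q i - O)) hsz
    simp only [sum_inner, inner_smul_left, inner_zero_left, conj_trivial] at h1
    have h2 : ∑ j, s j * inner ℝ (z j) (q i - O)
        ≤ ∑ j, (s j * r - if j = i then s i else 0) := by
      refine Finset.sum_le_sum fun j _ => ?_
      by_cases hj : j = i
      · subst hj
        rw [if_pos rfl]
        have := mul_le_mul_of_nonneg_left (hq j) (hs j).le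
        linarith
      · rw [if_neg hj, sub_zero]
        exact mul_le_mul_of_nonneg_left (hle j _ (hqK i)) (hs j).le
    rw [h1, Finset.sum_sub_distrib, ← Finset.sum_mul, hs1, Finset.sum_ite_eq' Finset.univ i] at h2
    simp only [Finset.mem_univ, if_true] at h2
    linarith
  -- Affine independence allows at most three normals; two or fewer would give total weight at most
  -- `2 * r < 1`.
  have hcard3 : Fintype.card ι = 3 := by
    have h1 := hind.card_le_finrank_succ
    have h2 := Submodule.finrank_le (vectorSpan ℝ (Set.range z))
    rw [finrank_euclideanSpace_fin] at h2
    have h3 : (1 : ℝ) ≤ Fintype.card ι * r := by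
      calc (1 : ℝ) = ∑ i, s i := hs1.symm
        _ ≤ ∑ _i : ι, r := Finset.sum_le_sum fun i _ => hsr i
        _ = _ := by rw [Finset.sum_const, nsmul_eq_mul, Finset.card_univ]
    have h4 : ¬ Fintype.card ι ≤ 2 := by
      intro h
      have h5 : (Fintype.card ι : ℝ) ≤ 2 := by exact_mod_cast h
      have h6 : (0 : ℝ) ≤ Fintype.card ι := by positivity
      nlinarith
    omega
  obtain ⟨e⟩ : Nonempty (Fin 3 ≃ ι) := ⟨(Fintype.equivFinOfCardEq hcard3).symm⟩
  have hsum : s (e 0) + s (e 1) + s (e 2) = 1 := by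
    rw [← hs1, ← e.sum_comp, Fin.sum_univ_three]
  have hzsum : s (e 0) • z (e 0) + s (e 1) • z (e 1) + s (e 2) • z (e 2) = 0 := by
    rw [← hsz, ← e.sum_comp, Fin.sum_univ_three]
  have hr3 : 1 / 3 ≤ r := by linarith [hsr (e 0), hsr (e 1), hsr (e 2)]
  have harea := le_abs_cross_of_contact (hn (e 0)) (hn (e 1)) (hn (e 2)) (hs _) (hs _) (hs _)
    hsum hzsum (by linarith) (hq (e 0)) (hle _ _ (hqK _)) (hle _ _ (hqK _)) (hle _ _ (hqK _))
    (hq (e 1)) (hle _ _ (hqK _)) (hle _ _ (hqK _)) (hle _ _ (hqK _)) (hq (e 2))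
  rw [sub_sub_sub_cancel_right, sub_sub_sub_cancel_right] at harea
  refine cheegerConstant_le_of_triangle hc hB (hqK (e 0)) (hqK (e 1)) (hqK (e 2)) ht0
    (by linarith) ?_
  have h3 : Real.sqrt 3 ^ 2 = 3 := Real.sq_sqrt (by norm_num)
  have h3' : 0 < Real.sqrt 3 := by positivity
  have hr0 : 0 < r := by linarith
  -- Equality holds at `r = 1 / 3`, the equilateral case. With `r = 1 / 3 + ε` and `d = 1 - 3 t` a
  -- factor `ε ≥ 0` splits off, and the numerical bounds on `t` and `r` make the cofactor
  -- nonnegative.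
  have hpoly : r * (1 - 3 * t) ^ 2 ≤ 9 * (1 - 2 * r) * (r - t) ^ 2 := by
    obtain ⟨ε, rfl⟩ : ∃ ε, r = 1 / 3 + ε := ⟨r - 1 / 3, by ring⟩
    obtain ⟨d, rfl⟩ : ∃ d, t = (1 - d) / 3 := ⟨1 - 3 * t, by ring⟩
    have hfac : 9 * (1 - 2 * (1 / 3 + ε)) * (1 / 3 + ε - (1 - d) / 3) ^ 2
        - (1 / 3 + ε) * (1 - 3 * ((1 - d) / 3)) ^ 2
        = ε * (2 * d - 3 * d ^ 2 + 3 * ε - 12 * d * ε - 18 * ε ^ 2) := by ring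
    have hε0 : 0 ≤ ε := by linarith
    have hfac2 : 0 ≤ 2 * d - 3 * d ^ 2 + 3 * ε - 12 * d * ε - 18 * ε ^ 2 := by nlinarith
    have := mul_nonneg hε0 hfac2
    linarith
  calc Real.pi * t ^ 2 = (1 - 3 * t) ^ 2 / Real.sqrt 3 := by rw [ht]; field_simp
    _ ≤ (1 - t / r) ^ 2 * (6 * Real.sqrt 3 * (r * (1 - 2 * r)) / 2) := by
      rw [div_le_iff₀ h3']
      have e1 : (1 - t / r) ^ 2 * (6 * Real.sqrt 3 * (r * (1 - 2 * r)) / 2) * Real.sqrt 3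
          = 9 * (1 - 2 * r) * (r - t) ^ 2 / r := by
        field_simp
        linear_combination (6 * (r - t) ^ 2 * (1 - 2 * r)) * h3
      rw [e1, le_div_iff₀ hr0]
      linarith
    _ ≤ _ := by gcongr

theorem exists_cheeger_parameter : ∃ t : ℝ, 187 / 1000 ≤ t ∧ t ≤ 188 / 1000 ∧
    (1 - 3 * t) ^ 2 = Real.sqrt 3 * Real.pi * t ^ 2 := by
  have hs1 : 1.732 ≤ Real.sqrt 3 := Real.le_sqrt_of_sq_le (by norm_num)
  have hs2 : Real.sqrt 3 ≤ 1.733 := by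
    rw [Real.sqrt_le_left (by norm_num)]; norm_num
  have hp1 := Real.pi_gt_d2
  have hp2 := Real.pi_lt_d2
  set x := Real.sqrt (Real.sqrt 3 * Real.pi) with hx
  have hx2 : x ^ 2 = Real.sqrt 3 * Real.pi := Real.sq_sqrt (by positivity)
  have hx1 : 2.32 ≤ x := Real.le_sqrt_of_sq_le (by nlinarith)
  have hx3 : x ≤ 2.34 := by
    rw [hx, Real.sqrt_le_left (by norm_num)]; nlinarith
  have hpos : 0 < 3 + x := by linarith
  -- This root comes from taking square roots as `1 - 3 t = x t`; the other sign gives a root above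
  -- 1.
  refine ⟨1 / (3 + x), ?_, ?_, ?_⟩
  · rw [le_div_iff₀ hpos]; linarith
  · rw [div_le_iff₀ hpos]; linarith
  · rw [← hx2]; field_simp; ring

theorem theorem1p2 :
    (∃ t : Affine.Triangle ℝ Plane, t.Equilateral ∧ HasWidth (triangleRegion t) 1) ∧
    ∀ t : Affine.Triangle ℝ Plane, t.Equilateral → HasWidth (triangleRegion t) 1 →
      ∀ K : ConvexBody Plane, WidthAtLeast (K : Set Plane) 1 →
        cheegerConstant (K : Set Plane) ≤ cheegerConstant (triangleRegion t) := by
  refine ⟨exists_equilateral_hasWidth_one, fun T hT hTw K hK => ?_⟩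
  obtain ⟨t, ht1, ht2, ht⟩ := exists_cheeger_parameter
  exact (cheegerConstant_le_of_widthAtLeast K.isCompact K.convex K.nonempty hK ht1 ht2 ht).trans
    (ofReal_le_cheegerConstant_triangle hT hTw (by linarith) ht)
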